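/- Setting. $N\ge 1$ agents communicate over directed graphs $(\mathcal V,\mathcal E_t)$, $\mathcal V=\{1,\dots,N\}$, $t\ge1$, where $(i,j)\in\mathcal E_t$ means that $i$ receives messages from $j$ at time $t$, with weight matrices $W_t$. For some $w\in(0,1)$ and some integer $B\ge1$: $[W_t]_{ij}\ge w$ if $(i,j)\in\mathcal E_t$ or $j=i$, and $[W_t]_{ij}=0$ otherwise; $W_t$ is doubly stochastic; and the graph with edge set $\bigcup_{l=0}^{B-1}\mathcal E_{t+l}$ is strongly connected for every $t\ge1$. Agent $i$ has (not necessarily convex) differentiable cost functions $f_{i,t}:\mathbb R^d\to\mathbb R$, $1\le t\le T$, with $L$-Lipschitz gradients; put $f_t=\sum_{i=1}^N f_{i,t}$. The agents have access to random maps $\widehat\nabla f_{i,t}:\mathbb R^d\to\mathbb R^d$. From initial states $x_{i,1}$ (deterministic or random) they run $$x_{i,t+1}=\sum_{j=1}^N[W_t]_{ij}x_{j,t}-\eta_t\,\mathrm{clip}_{\lambda_t}\big(\widehat\nabla f_{i,t}(x_{i,t})\big),\qquad \mathrm{clip}_\lambda(y)=\min\{1,\lambda/\|y\|\}\,y .$$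 Let $\mathcal F_t$ be the $\sigma$-algebra generated by the initial states and by $\widehat\nabla f_{j,s}(x_{j,s})$, $1\le j\le N$, $1\le s<t$. Assume that for some $\sigma>0$, $p\in(1,2]$, $B_X>0$, $B_g>0$ and all $1\le i\le N$, $1\le t\le T$, almost surely $$\mathbb E\big[\widehat\nabla f_{i,t}(x_{i,t})\,\big|\,\mathcal F_t\big]=\nabla f_{i,t}(x_{i,t}),\qquad \mathbb E\big[\|\widehat\nabla f_{i,t}(x_{i,t})-\nabla f_{i,t}(x_{i,t})\|^p\,\big|\,\mathcal F_t\big]\le\sigma^p,$$ $$\|x_{i,t}\|\le B_X,\qquad \|\nabla f_{i,t}(x_{i,t})\|\le B_g,\qquad \|\nabla f_{i,t}(\bar x_t)\|\le B_g,\qquad \bar x_t=\tfrac1N\sum_{j=1}^N x_{j,t}.$$ Let $$\mathbf{NREG}_T^d=\sum_{t=1}^T\sum_{i=1}^N\|\nabla f_t(x_{i,t})\|^2,\qquad D_T=\sum_{t=2}^T\sup_{x\in\mathbb R^d}|f_t(x)-f_{t-1}(x)|,$$ with $D_T$ finite. Corollary 2. Let $\lambda_t=2B_g t^{\alpha}$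 and $\eta_t=(at+b)^{-\kappa}$ with $\kappa=\frac{p+1}{2p}$, $\alpha=\frac1{2p}$, $a>0$ and $a+b>0$. Then there is a constant $C>0$, depending only on $N,p,\sigma,L,B_X,B_g,w,B,a,b$, such that for all $T\ge1$ and all $\delta\in(0,1)$, with probability at least $1-\delta$, $$\mathbf{NREG}_T^d\le C\,T^{\frac{1+p}{2p}}\Big(1+D_T+\log\frac1\delta\Big).$$ -/

import Mathlib

open MeasureTheory ProbabilityTheory
open scoped BigOperators NNReal

noncomputable section

namespace ODCSGD

/-- The decision space `ℝ^d` with its Euclidean norm. -/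
abbrev Vec (d : ℕ) : Type := EuclideanSpace ℝ (Fin d)

/-! ### Communication network -/

/-- The directed graph on the agents with edge relation `R` is strongly connected: any agent is
joined to any other one by a directed path. -/
def StronglyConnected {N : ℕ} (R : Fin N → Fin N → Prop) : Prop :=
  ∀ i j, Relation.ReflTransGen R i j

/-- The union of the edge sets at the times `t, …, t + B - 1`. -/
def unionEdges {N : ℕ} (edge : ℕ → Fin N → Fin N → Prop) (B t : ℕ) : Fin N → Fin N → Prop :=
  fun i j => ∃ l < B, edge (t + l) i j

/-- The assumption on the weighted graphs `(V, W t, edge t)`, `t ≥ 1`; `edge t i j` means that `i`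
receives messages from `j` at time `t`, and the in-neighbours of `i` are these `j` and `i` itself. -/
structure NetworkAssumption {N : ℕ} (w : ℝ) (B : ℕ) (edge : ℕ → Fin N → Fin N → Prop)
    (W : ℕ → Matrix (Fin N) (Fin N) ℝ) : Prop where
  weight_ge : ∀ t, 1 ≤ t → ∀ i j, (edge t i j ∨ j = i) → w ≤ W t i j
  weight_eq_zero : ∀ t, 1 ≤ t → ∀ i j, ¬ (edge t i j ∨ j = i) → W t i j = 0
  row_sum : ∀ t, 1 ≤ t → ∀ i, ∑ j, W t i j = 1
  col_sum : ∀ t, 1 ≤ t → ∀ j, ∑ i, W t i j = 1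
  connected : ∀ t, 1 ≤ t → StronglyConnected (unionEdges edge B t)

/-! ### The algorithm -/

/-- The clipping operator `y ↦ min {1, lam / ‖y‖} y`. -/
def clip {d : ℕ} (lam : ℝ) (y : Vec d) : Vec d := min 1 (lam / ‖y‖) • y

/-- The step size `1 / (a t + b) ^ κ`. -/
def stepSize (a b κ : ℝ) (t : ℕ) : ℝ := 1 / (a * t + b) ^ κ

/-- The clipping level `2 B_g t ^ α`. -/
def clipLevel (Bg α : ℝ) (t : ℕ) : ℝ := 2 * Bg * (t : ℝ) ^ α

/-- The states `x_{i,t}` of the agents for `t ≥ 1`, started at `x₁`, when `g i t` is the gradient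
estimator of agent `i` at time `t`:
`x_{i,t+1} = ∑ j, (W t) i j • x_{j,t} - η t • clip (lam t) (g i t (x_{i,t}))`.
The time index `0` is not used by the algorithm. -/
def states {N d : ℕ} (W : ℕ → Matrix (Fin N) (Fin N) ℝ) (η lam : ℕ → ℝ)
    (x₁ : Fin N → Vec d) (g : Fin N → ℕ → Vec d → Vec d) : ℕ → Fin N → Vec d
  | 0 => x₁
  | 1 => x₁
  | t + 2 => fun i =>
      ∑ j, W (t + 1) i j • states W η lam x₁ g (t + 1) j
        - η (t + 1) • clip (lam (t + 1)) (g i (t + 1) (states W η lam x₁ g (t + 1) i))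

/-- The average of the states. -/
def average {N d : ℕ} (x : Fin N → Vec d) : Vec d := (N : ℝ)⁻¹ • ∑ i, x i

/-- The random states `x_{i,t}`, for random initial states and random gradient estimators. -/
def randomStates {N d : ℕ} {Ω : Type*} (W : ℕ → Matrix (Fin N) (Fin N) ℝ) (η lam : ℕ → ℝ)
    (x₁ : Fin N → Ω → Vec d) (g : Fin N → ℕ → Ω → Vec d → Vec d) (t : ℕ) (i : Fin N) (ω : Ω) :
    Vec d :=
  states W η lam (fun j => x₁ j ω) (fun j s => g j s ω) t i

/-- The noisy gradient that agent `i` observes at time `t`: its estimator at its own state. -/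
def observed {N d : ℕ} {Ω : Type*} (g : Fin N → ℕ → Ω → Vec d → Vec d)
    (X : ℕ → Fin N → Ω → Vec d) (i : Fin N) (t : ℕ) (ω : Ω) : Vec d :=
  g i t ω (X t i ω)

/-- The information available before the gradients of time `t` are observed: the σ-algebra
generated by the initial states and the noisy gradients observed by all agents at the times
`1, …, t - 1`. -/
@[reducible] def history {N d : ℕ} {Ω : Type*} (x₁ : Fin N → Ω → Vec d) (G : Fin N → ℕ → Ω → Vec d) (t : ℕ) :
    MeasurableSpace Ω :=
  (⨆ j, MeasurableSpace.comap (x₁ j) inferInstance) ⊔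
    ⨆ s ∈ Finset.Ico 1 t, ⨆ j, MeasurableSpace.comap (G j s) inferInstance

/-! ### Assumptions on the cost functions and the gradient estimators -/

/-- `f` is `L`-smooth. -/
def LSmooth {d : ℕ} (L : ℝ≥0) (f : Vec d → ℝ) : Prop :=
  Differentiable ℝ f ∧ LipschitzWith L (gradient f)

/-- Given the past, the observed gradients are unbiased up to time `T`. -/
def Unbiased {N d : ℕ} {Ω : Type*} [MeasurableSpace Ω] (μ : Measure Ω) (T : ℕ)
    (f : Fin N → ℕ → Vec d → ℝ) (x₁ : Fin N → Ω → Vec d) (X : ℕ → Fin N → Ω → Vec d)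
    (G : Fin N → ℕ → Ω → Vec d) : Prop :=
  ∀ t ∈ Finset.Icc 1 T, ∀ i,
    Integrable (G i t) μ ∧
    μ[G i t | history x₁ G t] =ᵐ[μ] fun ω => gradient (f i t) (X t i ω)

/-- Given the past, the noise in the observed gradients has a `p`-th moment of at most `σ ^ p`, up
to time `T`. -/
def HeavyTailed {N d : ℕ} {Ω : Type*} [MeasurableSpace Ω] (μ : Measure Ω) (T : ℕ) (p σ : ℝ)
    (f : Fin N → ℕ → Vec d → ℝ) (x₁ : Fin N → Ω → Vec d) (X : ℕ → Fin N → Ω → Vec d)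
    (G : Fin N → ℕ → Ω → Vec d) : Prop :=
  ∀ t ∈ Finset.Icc 1 T, ∀ i,
    Integrable (fun ω => ‖G i t ω - gradient (f i t) (X t i ω)‖ ^ p) μ ∧
    μ[fun ω => ‖G i t ω - gradient (f i t) (X t i ω)‖ ^ p | history x₁ G t]
      ≤ᵐ[μ] fun _ => σ ^ p

/-- Almost surely, up to time `T`, the states are bounded by `BX`, and the local gradients at the
states and at their averages are bounded by `Bg`. -/
def BoundedStates {N d : ℕ} {Ω : Type*} [MeasurableSpace Ω] (μ : Measure Ω) (T : ℕ) (BX Bg : ℝ)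
    (f : Fin N → ℕ → Vec d → ℝ) (X : ℕ → Fin N → Ω → Vec d) : Prop :=
  ∀ᵐ ω ∂μ, ∀ t ∈ Finset.Icc 1 T, ∀ i,
    ‖X t i ω‖ ≤ BX ∧ ‖gradient (f i t) (X t i ω)‖ ≤ Bg ∧
      ‖gradient (f i t) (average fun j => X t j ω)‖ ≤ Bg

/-! ### Regret and variation -/

/-- The global cost `f_t = ∑ i, f_{i,t}`. -/
def globalCost {N d : ℕ} (f : Fin N → ℕ → Vec d → ℝ) (t : ℕ) (x : Vec d) : ℝ := ∑ i, f i t x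

/-- The dynamic regret `∑_{t=1}^T ∑_{i=1}^N ‖∇ f_t (x_{i,t})‖ ^ 2`. -/
def nreg {N d : ℕ} (f : Fin N → ℕ → Vec d → ℝ) (x : ℕ → Fin N → Vec d) (T : ℕ) : ℝ :=
  ∑ t ∈ Finset.Icc 1 T, ∑ i, ‖gradient (globalCost f t) (x t i)‖ ^ 2

/-- `‖f_t - f_{t-1}‖_sup` is finite for `2 ≤ t ≤ T`. -/
def FiniteVariation {N d : ℕ} (f : Fin N → ℕ → Vec d → ℝ) (T : ℕ) : Prop :=
  ∀ t ∈ Finset.Icc 2 T, BddAbove (Set.range fun x => |globalCost f t x - globalCost f (t - 1) x|)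

/-- The variation `D_T = ∑_{t=2}^T ‖f_t - f_{t-1}‖_sup`. -/
def variation {N d : ℕ} (f : Fin N → ℕ → Vec d → ℝ) (T : ℕ) : ℝ :=
  ∑ t ∈ Finset.Icc 2 T, ⨆ x, |globalCost f t x - globalCost f (t - 1) x|

end ODCSGD

end

/-! Double stochasticity makes the mean state `x̄_t` follow inexact gradient descent, `x̄_{t+1} =
x̄_t - η_t c̄_t`, where `c̄_t` is the mean of the clipped gradients. With `u_t = ∇f_t(x̄_t)`, the
vector `c̄_t` is `u_t / N`, plus a consensus error of norm at most `L` times the spread of the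
states, minus a clipping error. Smoothness of `f_t` then bounds `‖u_t‖² / N` by four terms
(`sq_norm_gradient_le`), and each of them sums to order `T ^ κ`, up to the factor `1 + D_T + log (1
/ δ)`.

Consensus: over `N * B` steps every entry of the transition matrix is at least `w ^ (N * B)`, so the
spread contracts up to perturbations `η_t λ_t`, and its sum is controlled by theirs
(`NetworkAssumption.sum_spread_le`).

Decrease of cost: the terms `η_t⁻¹ (f_t(x̄_t) - f_t(x̄_{t+1}))` are summed by parts
(`sum_mul_sub_le`). The weights increase and the costs along the path stay in a bounded range up to
`D_T`, which leaves `η_T⁻¹` times a constant plus a multiple of `D_T`.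

Second order: `η_t λ_t²` is of order `t ^ (-κ + 2α) = t ^ (κ - 1)`.

Clipping error: its conditional drift is at most of order `λ_t ^ (1 - p)`, because clipping at `λ_t
≥ 2 B_g` acts only when the noise is at least `λ_t / 2` (`norm_sub_clip_le`). It is also bounded by
a multiple of `t ^ α`, so the exponential-moment bound `measure_sum_ge_le` at scale `T ^ (-κ)`
controls the fluctuations by `T ^ κ (1 + log (1 / δ))`.

The relations `2α = 2κ - 1` and `α (1 - p) = κ - 1` make these orders agree, and they determine `α`
and `κ`. Passing from `x̄_t` back to the individual states costs one more multiple of the spread. -/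

noncomputable section

namespace ODCSGD

/-! ### Products of stochastic matrices and contraction of the spread -/

section Spread

variable {N : ℕ} {E : Type*} [NormedAddCommGroup E]

/-- The largest distance between two agents. -/
def spread (x : Fin N → E) : ℝ :=
  ((Finset.univ.sup fun q : Fin N × Fin N => ‖x q.1 - x q.2‖₊ : ℝ≥0) : ℝ)

theorem spread_nonneg (x : Fin N → E) : 0 ≤ spread x := NNReal.coe_nonneg _

theorem norm_sub_le_spread (x : Fin N → E) (i j : Fin N) : ‖x i - x j‖ ≤ spread x := by
  have := Finset.le_sup (f := fun q : Fin N × Fin N => ‖x q.1 - x q.2‖₊) (Finset.mem_univ (i, j))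
  exact_mod_cast this

theorem spread_le {x : Fin N → E} {c : ℝ} (hc : 0 ≤ c) (hx : ∀ i j, ‖x i - x j‖ ≤ c) :
    spread x ≤ c := by
  lift c to ℝ≥0 using hc
  rw [spread]
  exact_mod_cast Finset.sup_le fun q _ => by exact_mod_cast hx q.1 q.2

end Spread

section Stochastic

variable {N : ℕ} {E : Type*} [NormedAddCommGroup E] [NormedSpace ℝ E]

/-- A matrix with nonnegative entries whose rows sum to one. -/
structure RowStochastic (P : Matrix (Fin N) (Fin N) ℝ) : Prop where
  nonneg : ∀ i j, 0 ≤ P i j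
  row_sum : ∀ i, ∑ j, P i j = 1

theorem RowStochastic.one : RowStochastic (1 : Matrix (Fin N) (Fin N) ℝ) where
  nonneg i j := by
    rw [Matrix.one_apply]
    split_ifs <;> norm_num
  row_sum i := by simp [Matrix.one_apply]

theorem RowStochastic.mul {P Q : Matrix (Fin N) (Fin N) ℝ} (hP : RowStochastic P)
    (hQ : RowStochastic Q) : RowStochastic (P * Q) where
  nonneg i j := by
    rw [Matrix.mul_apply]
    exact Finset.sum_nonneg fun k _ => mul_nonneg (hP.nonneg i k) (hQ.nonneg k j)
  row_sum i := by
    simp only [Matrix.mul_apply]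
    rw [Finset.sum_comm]
    simp [← Finset.mul_sum, hQ.row_sum, hP.row_sum]

theorem RowStochastic.norm_sum_smul_le {P : Matrix (Fin N) (Fin N) ℝ} (hP : RowStochastic P)
    {x : Fin N → E} {c : ℝ} (hx : ∀ j, ‖x j‖ ≤ c) (i : Fin N) : ‖∑ j, P i j • x j‖ ≤ c := by
  calc ‖∑ j, P i j • x j‖ ≤ ∑ j, ‖P i j • x j‖ := norm_sum_le _ _
    _ ≤ ∑ j, P i j * c := by
        refine Finset.sum_le_sum fun j _ => ?_
        rw [norm_smul, Real.norm_of_nonneg (hP.nonneg i j)]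
        exact mul_le_mul_of_nonneg_left (hx j) (hP.nonneg i j)
    _ = c := by rw [← Finset.sum_mul, hP.row_sum, one_mul]

/-- Averaging with a stochastic matrix whose entries are at least `ε` contracts the spread. -/
theorem RowStochastic.norm_sub_le {P : Matrix (Fin N) (Fin N) ℝ} (hP : RowStochastic P)
    {ε : ℝ} (hε : 0 ≤ ε) (hPε : ∀ i j, ε ≤ P i j) {x : Fin N → E} {D : ℝ}
    (hx : ∀ i j, ‖x i - x j‖ ≤ D) (i j : Fin N) :
    ‖∑ k, P i k • x k - ∑ k, P j k • x k‖ ≤ (1 - ε ^ 2) * D := by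
  have hD : 0 ≤ D := (norm_nonneg _).trans (hx i i)
  -- Couple the two rows independently: the difference of the means is the mean of `x k - x l` under
  -- the product weights, and the diagonal `k = l` contributes nothing.
  have h1 : ∑ k, P i k • x k - ∑ k, P j k • x k
      = ∑ k, ∑ l, (P i k * P j l) • (x k - x l) := by
    simp only [smul_sub, Finset.sum_sub_distrib]
    congr 1
    · refine Finset.sum_congr rfl fun k _ => ?_
      rw [← Finset.sum_smul, ← Finset.mul_sum, hP.row_sum, mul_one]
    · rw [Finset.sum_comm]
      refine Finset.sum_congr rfl fun k _ => ?_
      rw [← Finset.sum_smul, ← Finset.sum_mul, hP.row_sum, one_mul]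
  have h2 : ∀ k l, ‖(P i k * P j l) • (x k - x l)‖
      ≤ (P i k * P j l) * D - if k = l then (P i k * P j l) * D else 0 := by
    intro k l
    have hkl : 0 ≤ P i k * P j l := mul_nonneg (hP.nonneg i k) (hP.nonneg j l)
    split_ifs with h
    · simp [h]
    · rw [norm_smul, Real.norm_of_nonneg hkl, sub_zero]
      exact mul_le_mul_of_nonneg_left (hx k l) hkl
  have h3 : ∑ k, ∑ l, ((P i k * P j l) * D - if k = l then (P i k * P j l) * D else 0)
      = D - (∑ k, P i k * P j k) * D := by
    simp only [Finset.sum_sub_distrib, Finset.sum_ite_eq, Finset.mem_univ, if_true]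
    congr 1
    · simp only [← Finset.sum_mul, ← Finset.mul_sum, hP.row_sum, mul_one, one_mul]
    · rw [Finset.sum_mul]
  -- The saved mass is the diagonal of the coupling; one of its terms is already enough.
  have h4 : ε ^ 2 ≤ ∑ k, P i k * P j k := by
    calc ε ^ 2 = ε * ε := sq ε
      _ ≤ P i i * P j i := mul_le_mul (hPε i i) (hPε j i) hε (hP.nonneg i i)
      _ ≤ ∑ k, P i k * P j k :=
        Finset.single_le_sum (f := fun k => P i k * P j k)
          (fun k _ => mul_nonneg (hP.nonneg i k) (hP.nonneg j k)) (Finset.mem_univ i)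
  rw [h1]
  calc _ ≤ ∑ k, ∑ l, ‖(P i k * P j l) • (x k - x l)‖ :=
        (norm_sum_le _ _).trans (Finset.sum_le_sum fun k _ => norm_sum_le _ _)
    _ ≤ D - (∑ k, P i k * P j k) * D :=
        (Finset.sum_le_sum fun k _ => Finset.sum_le_sum fun l _ => h2 k l).trans_eq h3
    _ ≤ (1 - ε ^ 2) * D := by nlinarith

/-- The transition matrix `W (s + k - 1) ⋯ W s` over `k` steps from time `s`. -/
def transition (W : ℕ → Matrix (Fin N) (Fin N) ℝ) (s : ℕ) : ℕ → Matrix (Fin N) (Fin N) ℝ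
  | 0 => 1
  | k + 1 => W (s + k) * transition W s k

end Stochastic

/-! ### Joint connectivity and positivity of long matrix products -/

section Network

variable {N : ℕ} {w : ℝ} {B : ℕ} {edge : ℕ → Fin N → Fin N → Prop}
  {W : ℕ → Matrix (Fin N) (Fin N) ℝ}

theorem NetworkAssumption.rowStochastic (h : NetworkAssumption w B edge W) (hw : 0 < w) {t : ℕ}
    (ht : 1 ≤ t) : RowStochastic (W t) where
  nonneg i j := by
    by_cases hij : edge t i j ∨ j = i
    · exact hw.le.trans (h.weight_ge t ht i j hij)
    · exact (h.weight_eq_zero t ht i j hij).ge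
  row_sum := h.row_sum t ht

theorem NetworkAssumption.rowStochastic_transition (h : NetworkAssumption w B edge W) (hw : 0 < w)
    {s : ℕ} (hs : 1 ≤ s) (k : ℕ) : RowStochastic (transition W s k) := by
  induction k with
  | zero => exact RowStochastic.one
  | succ k ih => exact (h.rowStochastic hw (by omega)).mul ih

/-- Following an edge or a self-loop costs one factor `w`, since the path contributes one
nonnegative term to the matrix product. -/
theorem NetworkAssumption.transition_succ_ge (h : NetworkAssumption w B edge W) (hw : 0 < w)
    {s : ℕ} (hs : 1 ≤ s) {k : ℕ} {i j m : Fin N} (hij : edge (s + k) i j ∨ j = i)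
    (hj : w ^ k ≤ transition W s k j m) : w ^ (k + 1) ≤ transition W s (k + 1) i m := by
  have hW := h.rowStochastic hw (t := s + k) (by omega)
  have hT := h.rowStochastic_transition hw hs k
  calc w ^ (k + 1) = w * w ^ k := pow_succ' w k
    _ ≤ W (s + k) i j * transition W s k j m :=
        mul_le_mul (h.weight_ge _ (by omega) i j hij) hj (by positivity) (hW.nonneg i j)
    _ ≤ ∑ l, W (s + k) i l * transition W s k l m :=
        Finset.single_le_sum (f := fun l => W (s + k) i l * transition W s k l m)
          (fun l _ => mul_nonneg (hW.nonneg i l) (hT.nonneg l m)) (Finset.mem_univ j)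
    _ = transition W s (k + 1) i m := by rw [transition, Matrix.mul_apply]

theorem NetworkAssumption.transition_add_ge (h : NetworkAssumption w B edge W) (hw : 0 < w)
    {s : ℕ} (hs : 1 ≤ s) {k : ℕ} {i m : Fin N}
    (hi : w ^ k ≤ transition W s k i m) (l : ℕ) :
    w ^ (k + l) ≤ transition W s (k + l) i m := by
  induction l with
  | zero => exact hi
  | succ l ih => exact h.transition_succ_ge hw hs (Or.inr rfl) ih

/-- The agents whom the message of agent `m` of time `s` has reached after `k` steps, with the
weight guaranteed by the length of the path. -/
def reached (w : ℝ) (W : ℕ → Matrix (Fin N) (Fin N) ℝ) (s : ℕ) (m : Fin N) (k : ℕ) :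
    Finset (Fin N) := by
  classical exact {i | w ^ k ≤ transition W s k i m}

theorem mem_reached {s : ℕ} {m : Fin N} {k : ℕ} {i : Fin N} :
    i ∈ reached w W s m k ↔ w ^ k ≤ transition W s k i m := by
  simp [reached]

/-- A set that a directed path enters is entered along one of the edges of the path. -/
theorem exists_edge_into {R : Fin N → Fin N → Prop} {S : Finset (Fin N)} {i j : Fin N}
    (hij : Relation.ReflTransGen R i j) (hi : i ∉ S) (hj : j ∈ S) :
    ∃ u v, R u v ∧ u ∉ S ∧ v ∈ S := by
  induction hij using Relation.ReflTransGen.head_induction_on with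
  | refl => exact absurd hj hi
  | head hac _ ih =>
    rename_i a c _
    by_cases hc : c ∈ S
    · exact ⟨a, c, hac, hi, hc⟩
    · exact ih hc

/-- In each window of `B` steps the reached set gains an agent unless it is already full: a path in
the union graph from an unreached agent to `m` must cross into the set, and the agent at the outer
end of that edge receives the message. -/
theorem NetworkAssumption.card_reached (h : NetworkAssumption w B edge W) (hw : 0 < w)
    {s : ℕ} (hs : 1 ≤ s) (m : Fin N) (n : ℕ) :
    min N (n + 1) ≤ (reached w W s m (n * B)).card := by
  induction n with
  | zero =>
    have : m ∈ reached w W s m (0 * B) := by simp [mem_reached, transition]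
    exact (min_le_right _ _).trans (Finset.card_pos.2 ⟨m, this⟩)
  | succ n ih =>
    have hsub : reached w W s m (n * B) ⊆ reached w W s m ((n + 1) * B) := by
      intro i hi
      rw [mem_reached] at hi ⊢
      rw [Nat.succ_mul]
      exact h.transition_add_ge hw hs hi B
    by_cases hfull : reached w W s m (n * B) = Finset.univ
    · have := Finset.card_le_card hsub
      rw [hfull, Finset.card_univ, Fintype.card_fin] at this
      exact (min_le_left _ _).trans this
    · obtain ⟨i, hi⟩ : ∃ i, i ∉ reached w W s m (n * B) := by
        by_contra hcon
        push Not at hcon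
        exact hfull (Finset.eq_univ_iff_forall.2 hcon)
      have hm : m ∈ reached w W s m (n * B) := by
        have h0 : w ^ 0 ≤ transition W s 0 m m := by simp [transition]
        have := h.transition_add_ge hw hs h0 (n * B)
        rw [Nat.zero_add] at this
        exact mem_reached.2 this
      obtain ⟨u, v, ⟨l, hl, huv⟩, hu, hv⟩ :=
        exists_edge_into (h.connected (s + n * B) (by omega) i m) hi hm
      have hu' : u ∈ reached w W s m ((n + 1) * B) := by
        have h1 := h.transition_add_ge hw hs (mem_reached.1 hv) l
        rw [add_assoc] at huv
        have h2 := h.transition_succ_ge hw hs (Or.inl huv) h1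
        have h3 := h.transition_add_ge hw hs h2 (B - (l + 1))
        have h4 : n * B + l + 1 + (B - (l + 1)) = (n + 1) * B := by
          rw [Nat.succ_mul]; omega
        rw [h4] at h3
        exact mem_reached.2 h3
      have hlt := Finset.card_lt_card (Finset.ssubset_iff_subset_ne.2
        ⟨hsub, fun heq => hu (heq ▸ hu')⟩)
      omega

/-- All entries of the transition matrices over `N * B` steps are at least `w ^ (N * B)`. -/
theorem NetworkAssumption.transition_ge (h : NetworkAssumption w B edge W) (hw : 0 < w)
    {s : ℕ} (hs : 1 ≤ s) (i j : Fin N) :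
    w ^ (N * B) ≤ transition W s (N * B) i j := by
  have h1 := h.card_reached hw hs j N
  rw [min_eq_left (Nat.le_succ N)] at h1
  have h2 : reached w W s j (N * B) = Finset.univ := by
    apply Finset.eq_univ_of_card
    have := Finset.card_le_univ (reached w W s j (N * B))
    rw [Fintype.card_fin] at this ⊢
    omega
  exact mem_reached.1 (h2 ▸ Finset.mem_univ i)

/-! ### Perturbed averaging -/

section Dynamics

variable {E : Type*} [NormedAddCommGroup E] [NormedSpace ℝ E]

/-- Perturbed averaging stays close to the unperturbed one. -/
theorem NetworkAssumption.norm_sub_transition_le (h : NetworkAssumption w B edge W) (hw : 0 < w)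
    {x : ℕ → Fin N → E} {e : ℕ → ℝ} {s : ℕ} (hs : 1 ≤ s) (k : ℕ)
    (hx : ∀ t, s ≤ t → t < s + k → ∀ i, ‖x (t + 1) i - ∑ j, W t i j • x t j‖ ≤ e t)
    (i : Fin N) :
    ‖x (s + k) i - ∑ j, transition W s k i j • x s j‖ ≤ ∑ r ∈ Finset.Ico s (s + k), e r := by
  induction k generalizing i with
  | zero => simp [transition, Matrix.one_apply]
  | succ k ih =>
    have h1 := ih fun t h1 h2 => hx t h1 (by omega)
    have hW := h.rowStochastic hw (t := s + k) (by omega)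
    have h2 : ∑ j, transition W s (k + 1) i j • x s j
        = ∑ l, W (s + k) i l • ∑ j, transition W s k l j • x s j := by
      simp only [transition, Matrix.mul_apply, Finset.sum_smul, Finset.smul_sum, mul_smul]
      exact Finset.sum_comm
    have h3 : x (s + (k + 1)) i - ∑ j, transition W s (k + 1) i j • x s j
        = (x (s + k + 1) i - ∑ j, W (s + k) i j • x (s + k) j)
          + ∑ l, W (s + k) i l • (x (s + k) l - ∑ j, transition W s k l j • x s j) := by
      rw [h2]
      simp only [smul_sub, Finset.sum_sub_distrib, ← add_assoc]
      abel
    rw [h3, ← add_assoc, Finset.sum_Ico_succ_top (by omega), add_comm (Finset.sum _ _)]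
    exact (norm_add_le _ _).trans
      (add_le_add (hx (s + k) (by omega) (by omega) i) (hW.norm_sum_smul_le h1 i))

/-- Compare with unperturbed averaging from time `s`, whose transition matrix is entrywise at least
`w ^ (N * B)` and hence contracts; both agents of a pair may deviate from it, hence the factor 2. -/
theorem NetworkAssumption.spread_add_le (h : NetworkAssumption w B edge W) (hw : 0 < w)
    (hw1 : w < 1) {x : ℕ → Fin N → E} {e : ℕ → ℝ} (he : ∀ t, 0 ≤ e t) {s : ℕ} (hs : 1 ≤ s)
    (hx : ∀ t, s ≤ t → t < s + N * B → ∀ i, ‖x (t + 1) i - ∑ j, W t i j • x t j‖ ≤ e t) :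
    spread (x (s + N * B)) ≤ (1 - (w ^ (N * B)) ^ 2) * spread (x s)
      + 2 * ∑ r ∈ Finset.Ico s (s + N * B), e r := by
  have hε : 0 ≤ w ^ (N * B) := by positivity
  have hε1 : (w ^ (N * B)) ^ 2 ≤ 1 := pow_le_one₀ hε (pow_le_one₀ hw.le hw1.le)
  have hsum : 0 ≤ ∑ r ∈ Finset.Ico s (s + N * B), e r := Finset.sum_nonneg fun r _ => he r
  refine spread_le
    (add_nonneg (mul_nonneg (by linarith) (spread_nonneg _)) (by linarith)) fun i j => ?_
  have h1 := (h.rowStochastic_transition hw hs (N * B)).norm_sub_le hε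
    (h.transition_ge hw hs) (norm_sub_le_spread (x s)) i j
  have h2 := h.norm_sub_transition_le hw hs (N * B) hx i
  have h3 := h.norm_sub_transition_le hw hs (N * B) hx j
  set y := fun i => ∑ j, transition W s (N * B) i j • x s j
  calc ‖x (s + N * B) i - x (s + N * B) j‖
      = ‖(x (s + N * B) i - y i) + (y i - y j) - (x (s + N * B) j - y j)‖ := by
        congr 1; abel
    _ ≤ ‖x (s + N * B) i - y i‖ + ‖y i - y j‖ + ‖x (s + N * B) j - y j‖ :=
        (norm_sub_le _ _).trans (add_le_add_left (norm_add_le _ _) _)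
    _ ≤ _ := by linarith

/-- The accumulated spread of perturbed averaging is bounded by the accumulated perturbation. -/
theorem NetworkAssumption.sum_spread_le (h : NetworkAssumption w B edge W) (hw : 0 < w)
    (hw1 : w < 1) {x : ℕ → Fin N → E} {e : ℕ → ℝ} (he : ∀ t, 0 ≤ e t) {T : ℕ} {D : ℝ}
    (hx : ∀ t, 1 ≤ t → t < T → ∀ i, ‖x (t + 1) i - ∑ j, W t i j • x t j‖ ≤ e t)
    (hD : 0 ≤ D) (hxD : ∀ t ∈ Finset.Icc 1 T, spread (x t) ≤ D) :
    (w ^ (N * B)) ^ 2 * ∑ t ∈ Finset.Icc 1 T, spread (x t)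
      ≤ (N * B : ℕ) * (D + 2 * ∑ t ∈ Finset.Ico 1 T, e t) := by
  set M := N * B
  set ρ := 1 - (w ^ M) ^ 2 with hρ
  have hε : 0 ≤ w ^ M := by positivity
  have hρ0 : 0 ≤ ρ := by
    have : (w ^ M) ^ 2 ≤ 1 := pow_le_one₀ hε (pow_le_one₀ hw.le hw1.le)
    linarith
  have hE : 0 ≤ ∑ t ∈ Finset.Ico 1 T, e t := Finset.sum_nonneg fun t _ => he t
  have hstep : ∀ t ∈ Finset.Icc 1 (T - M), spread (x (t + M)) ≤
      ρ * spread (x t) + 2 * ∑ r ∈ Finset.Ico t (t + M), e r := by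
    intro t ht
    rw [Finset.mem_Icc] at ht
    exact h.spread_add_le hw hw1 he ht.1 fun r h1 h2 => hx r (by omega) (by omega)
  -- The first `M` times are bounded trivially by `D`; every later time is a shift by `M` of an
  -- earlier one, where the contraction applies. The `min M T` is there because `D` is a bound only
  -- up to `T`.
  have hsplit : ∑ t ∈ Finset.Icc 1 T, spread (x t)
      ≤ M * D + ∑ t ∈ Finset.Icc 1 (T - M), spread (x (t + M)) := by
    have hsub : Finset.Icc 1 T ⊆ Finset.Icc 1 (min M T) ∪ (Finset.Icc 1 (T - M)).image (· + M) := by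
      intro t ht
      simp only [Finset.mem_union, Finset.mem_image, Finset.mem_Icc] at ht ⊢
      by_cases htM : t ≤ M
      · left; omega
      · right; exact ⟨t - M, by omega, by omega⟩
    calc ∑ t ∈ Finset.Icc 1 T, spread (x t)
        ≤ ∑ t ∈ Finset.Icc 1 (min M T) ∪ (Finset.Icc 1 (T - M)).image (· + M), spread (x t) :=
          Finset.sum_le_sum_of_subset_of_nonneg hsub fun t _ _ => spread_nonneg _
      _ ≤ ∑ t ∈ Finset.Icc 1 (min M T), spread (x t)
          + ∑ t ∈ (Finset.Icc 1 (T - M)).image (· + M), spread (x t) := by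
          rw [← Finset.sum_union_inter]
          exact le_add_of_nonneg_right (Finset.sum_nonneg fun t _ => spread_nonneg _)
      _ ≤ _ := by
          rw [Finset.sum_image fun a _ b _ hab => Nat.add_right_cancel hab]
          refine add_le_add_left ?_ _
          calc ∑ t ∈ Finset.Icc 1 (min M T), spread (x t)
              ≤ ∑ t ∈ Finset.Icc 1 (min M T), D := Finset.sum_le_sum fun t ht => hxD t <| by
                rw [Finset.mem_Icc] at ht ⊢; omega
            _ = (min M T : ℕ) * D := by simp
            _ ≤ M * D := by gcongr; exact min_le_left _ _
  -- Each perturbation lies in at most `M` of the windows.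
  have hdouble : ∑ t ∈ Finset.Icc 1 (T - M), ∑ r ∈ Finset.Ico t (t + M), e r
      ≤ M * ∑ t ∈ Finset.Ico 1 T, e t := by
    have h1 : ∀ t, ∑ r ∈ Finset.Ico t (t + M), e r = ∑ k ∈ Finset.range M, e (t + k) := by
      intro t
      rw [Finset.sum_Ico_eq_sum_range, Nat.add_sub_cancel_left]
    simp only [h1]
    rw [Finset.sum_comm]
    calc ∑ k ∈ Finset.range M, ∑ t ∈ Finset.Icc 1 (T - M), e (t + k)
        ≤ ∑ k ∈ Finset.range M, ∑ t ∈ Finset.Ico 1 T, e t := by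
          refine Finset.sum_le_sum fun k hk => ?_
          rw [Finset.mem_range] at hk
          rw [← Finset.sum_image (f := e) (g := (· + k)) fun a _ b _ hab =>
            Nat.add_right_cancel hab]
          refine Finset.sum_le_sum_of_subset_of_nonneg ?_ fun t _ _ => he t
          intro t ht
          simp only [Finset.mem_image, Finset.mem_Icc, Finset.mem_Ico] at ht ⊢
          obtain ⟨r, hr, rfl⟩ := ht
          omega
      _ = M * ∑ t ∈ Finset.Ico 1 T, e t := by simp
  have hmain : ∑ t ∈ Finset.Icc 1 (T - M), spread (x (t + M)) ≤
      ρ * ∑ t ∈ Finset.Icc 1 T, spread (x t) + 2 * (M * ∑ t ∈ Finset.Ico 1 T, e t) := by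
    calc ∑ t ∈ Finset.Icc 1 (T - M), spread (x (t + M))
        ≤ ∑ t ∈ Finset.Icc 1 (T - M),
            (ρ * spread (x t) + 2 * ∑ r ∈ Finset.Ico t (t + M), e r) := Finset.sum_le_sum hstep
      _ = ρ * ∑ t ∈ Finset.Icc 1 (T - M), spread (x t)
          + 2 * ∑ t ∈ Finset.Icc 1 (T - M), ∑ r ∈ Finset.Ico t (t + M), e r := by
          rw [Finset.sum_add_distrib, Finset.mul_sum, Finset.mul_sum]
      _ ≤ _ := by
          refine add_le_add (mul_le_mul_of_nonneg_left ?_ hρ0) (by linarith)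
          exact Finset.sum_le_sum_of_subset_of_nonneg
            (Finset.Icc_subset_Icc_right (Nat.sub_le _ _)) fun t _ _ => spread_nonneg _
  -- The total spread now appears on both sides, with factor `ρ` on the right; moving it over leaves
  -- `1 - ρ`.
  have : (w ^ M) ^ 2 = 1 - ρ := by rw [hρ]; ring
  rw [this]
  linarith

end Dynamics

end Network

/-! ### Smooth functions -/

section Smooth

variable {d : ℕ} {L : ℝ≥0}

/-- A smooth function is close to its linearisations. -/
theorem LSmooth.abs_sub_sub_inner_le {f : Vec d → ℝ} (hf : LSmooth L f) (x y : Vec d) :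
    |f y - f x - inner ℝ (gradient f x) (y - x)| ≤ L * ‖y - x‖ ^ 2 := by
  have h1 : ∀ z ∈ segment ℝ x y,
      HasFDerivWithinAt f ((InnerProductSpace.toDual ℝ (Vec d)) (gradient f z))
        (segment ℝ x y) z := fun z _ => (hf.1 z).hasGradientAt.hasFDerivAt.hasFDerivWithinAt
  have h2 : ∀ z ∈ segment ℝ x y,
      ‖(InnerProductSpace.toDual ℝ (Vec d)) (gradient f z)
        - (InnerProductSpace.toDual ℝ (Vec d)) (gradient f x)‖ ≤ L * ‖y - x‖ := by
    intro z hz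
    rw [← map_sub, LinearIsometryEquiv.norm_map]
    refine (hf.2.norm_sub_le z x).trans (mul_le_mul_of_nonneg_left ?_ L.2)
    obtain ⟨a, b, ha, hb, hab, rfl⟩ := hz
    have : a • x + b • y - x = b • (y - x) := by
      rw [← eq_sub_iff_add_eq] at hab
      rw [hab, sub_smul, one_smul, smul_sub]
      abel
    rw [this, norm_smul, Real.norm_of_nonneg hb]
    exact mul_le_of_le_one_left (norm_nonneg _) (by linarith)
  -- The mean value inequality yields the constant `L` instead of the sharp `L / 2`, which affects
  -- only constants.
  have h3 := (convex_segment x y).norm_image_sub_le_of_norm_hasFDerivWithin_le' h1 h2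
    (left_mem_segment ℝ x y) (right_mem_segment ℝ x y)
  rw [InnerProductSpace.toDual_apply_apply, Real.norm_eq_abs] at h3
  rwa [sq, ← mul_assoc]

theorem gradient_globalCost {N : ℕ} {f : Fin N → ℕ → Vec d → ℝ} {t : ℕ}
    (hf : ∀ i, Differentiable ℝ (f i t)) (x : Vec d) :
    gradient (globalCost f t) x = ∑ i, gradient (f i t) x := by
  apply HasGradientAt.gradient
  rw [hasGradientAt_iff_hasFDerivAt, map_sum]
  exact HasFDerivAt.fun_sum fun i _ => (hf i x).hasGradientAt.hasFDerivAt

theorem LSmooth.globalCost {N : ℕ} {f : Fin N → ℕ → Vec d → ℝ} {t : ℕ}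
    (hf : ∀ i, LSmooth L (f i t)) : LSmooth (N * L) (globalCost f t) := by
  refine ⟨?_, LipschitzWith.of_dist_le_mul fun x y => ?_⟩
  · unfold ODCSGD.globalCost
    exact Differentiable.fun_sum fun i _ => (hf i).1
  · rw [gradient_globalCost fun i => (hf i).1, gradient_globalCost fun i => (hf i).1,
      dist_eq_norm, dist_eq_norm, ← Finset.sum_sub_distrib]
    calc ‖∑ i, (gradient (f i t) x - gradient (f i t) y)‖
        ≤ ∑ i, ‖gradient (f i t) x - gradient (f i t) y‖ := norm_sum_le _ _
      _ ≤ ∑ _i : Fin N, L * ‖x - y‖ := Finset.sum_le_sum fun i _ => (hf i).2.norm_sub_le x y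
      _ = _ := by simp [mul_assoc]

end Smooth

/-! ### Averages -/

section Average

variable {N d : ℕ}

theorem norm_average_le {x : Fin N → Vec d} {c : ℝ} (hc : 0 ≤ c) (hx : ∀ i, ‖x i‖ ≤ c) :
    ‖average x‖ ≤ c := by
  rw [average, norm_smul, norm_inv, RCLike.norm_natCast]
  have h : ‖∑ i, x i‖ ≤ N * c :=
    (norm_sum_le _ _).trans ((Finset.sum_le_sum fun i _ => hx i).trans_eq (by simp))
  rcases Nat.eq_zero_or_pos N with rfl | hN
  · simpa using hc
  · rw [inv_mul_le_iff₀ (by exact_mod_cast hN)]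
    exact h

theorem norm_sub_average_le_spread (x : Fin N → Vec d) (i : Fin N) :
    ‖x i - average x‖ ≤ spread x := by
  have hN : (N : ℝ) ≠ 0 := by
    have := i.pos
    positivity
  have h : x i - average x = average fun j => x i - x j := by
    rw [average, average, Finset.sum_sub_distrib, smul_sub]
    simp [← Nat.cast_smul_eq_nsmul ℝ, smul_smul, hN]
  rw [h]
  exact norm_average_le (spread_nonneg x) fun j => norm_sub_le_spread x i j

theorem measurable_average {Ω : Type*} {m : MeasurableSpace Ω} {x : Fin N → Ω → Vec d}
    (hx : ∀ i, Measurable (x i)) : Measurable fun ω => average fun i => x i ω := by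
  unfold average
  fun_prop

end Average

/-! ### Clipping -/

section Clip

variable {d : ℕ} {lam : ℝ}

theorem norm_clip_le (hlam : 0 ≤ lam) (y : Vec d) : ‖clip lam y‖ ≤ lam := by
  have h0 : 0 ≤ min 1 (lam / ‖y‖) := le_min zero_le_one (by positivity)
  rw [clip, norm_smul, Real.norm_of_nonneg h0]
  rcases eq_or_ne y 0 with rfl | hy
  · simpa using hlam
  · have : 0 < ‖y‖ := norm_pos_iff.2 hy
    calc min 1 (lam / ‖y‖) * ‖y‖ ≤ lam / ‖y‖ * ‖y‖ := by gcongr; exact min_le_right _ _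
      _ = lam := div_mul_cancel₀ _ this.ne'

/-- The clipping error is controlled by the `p`-th power of the distance to the ball of half the
clipping radius. -/
theorem norm_sub_clip_le (hlam : 0 < lam) {p : ℝ} (hp : 1 < p) {m : Vec d} (hm : ‖m‖ ≤ lam / 2)
    (y : Vec d) : ‖y - clip lam y‖ ≤ (lam / 2) ^ (1 - p) * ‖y - m‖ ^ p := by
  have hR : 0 ≤ (lam / 2) ^ (1 - p) * ‖y - m‖ ^ p := by positivity
  rcases eq_or_ne y 0 with rfl | hy
  · simpa [clip] using hR
  have hy0 : 0 < ‖y‖ := norm_pos_iff.2 hy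
  rcases le_or_gt ‖y‖ lam with h | h
  · have : clip lam y = y := by rw [clip, min_eq_left ((one_le_div hy0).2 h), one_smul]
    simpa [this] using hR
  · have h1 : min 1 (lam / ‖y‖) = lam / ‖y‖ := min_eq_right ((div_le_one hy0).2 h.le)
    have h2 : ‖y - clip lam y‖ = ‖y‖ - lam := by
      have h3 : y - clip lam y = (1 - lam / ‖y‖) • y := by rw [clip, h1, sub_smul, one_smul]
      rw [h3, norm_smul, Real.norm_of_nonneg (sub_nonneg.2 ((div_le_one hy0).2 h.le)), sub_mul,
        one_mul, div_mul_cancel₀ _ hy0.ne']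
    have h3 : ‖y‖ ≤ ‖y - m‖ + ‖m‖ := by simpa using norm_add_le (y - m) m
    -- Active clipping forces `y` away from `m`, so one power of the distance can be traded for its
    -- `p`-th power.
    have h4 : lam / 2 ≤ ‖y - m‖ := by linarith
    have h5 : 0 < ‖y - m‖ := by linarith
    calc ‖y - clip lam y‖ ≤ ‖y - m‖ := by rw [h2]; linarith
      _ = ‖y - m‖ ^ (1 - p) * ‖y - m‖ ^ p := by
          rw [← Real.rpow_add h5, sub_add_cancel, Real.rpow_one]
      _ ≤ _ := by
          gcongr ?_ * _
          exact Real.rpow_le_rpow_of_nonpos (by linarith) h4 (by linarith)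

theorem measurable_clip : Measurable (clip (d := d) lam) := by
  unfold clip
  exact (measurable_const.min (measurable_const.div measurable_norm)).smul measurable_id

end Clip

/-! ### Sums and step sizes -/

section Sums

/-- Summation by parts with increasing weights `θ`: here `H t` is the value that `F (t + 1)` is
compared with. -/
theorem sum_mul_sub_le {θ F H q : ℕ → ℝ} {K : ℝ} {T : ℕ} (hT : 1 ≤ T)
    (hθ0 : ∀ t, 1 ≤ t → 0 ≤ θ t) (hθ : ∀ t, 1 ≤ t → θ t ≤ θ (t + 1))
    (hF : ∀ t, 1 ≤ t → t ≤ T → |F t - F 1| ≤ K) (hq : ∀ t, 2 ≤ t → t ≤ T → 0 ≤ q t)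
    (hH : ∀ t, 1 ≤ t → t < T → F (t + 1) - H t ≤ q (t + 1)) :
    ∑ t ∈ Finset.Ico 1 T, θ t * (F t - H t) ≤ θ T * (2 * K + ∑ t ∈ Finset.Icc 2 T, q t) := by
  -- The slack `K - (F n - F 1)` is nonnegative, and carrying it in the induction is what allows `θ
  -- n` to be replaced by the larger `θ (n + 1)`.
  suffices h : ∀ n, 1 ≤ n → n ≤ T → ∑ t ∈ Finset.Ico 1 n, θ t * (F t - H t)
      ≤ θ n * (K - (F n - F 1) + ∑ t ∈ Finset.Icc 2 n, q t) by
    refine (h T hT le_rfl).trans (mul_le_mul_of_nonneg_left ?_ (hθ0 T hT))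
    linarith [(abs_le.1 (hF T hT le_rfl)).1]
  intro n hn
  induction n, hn using Nat.le_induction with
  | base =>
    intro _
    have hK : 0 ≤ K := by simpa using hF 1 le_rfl hT
    simpa using mul_nonneg (hθ0 1 le_rfl) hK
  | succ n hn ih =>
    intro hnT
    have h1 := ih (by omega)
    rw [Finset.sum_Ico_succ_top hn, Finset.sum_Icc_succ_top (by omega)]
    have h2 := hH n hn (by omega)
    have h3 : 0 ≤ ∑ t ∈ Finset.Icc 2 n, q t := Finset.sum_nonneg fun t ht => by
      rw [Finset.mem_Icc] at ht
      exact hq t ht.1 (by omega)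
    have h4 := hq (n + 1) (by omega) hnT
    have h5 := (abs_le.1 (hF (n + 1) (by omega) hnT)).2
    have h6 := hθ n hn
    have h7 := hθ0 n hn
    set S := ∑ t ∈ Finset.Icc 2 n, q t
    calc _ ≤ θ n * (K - (F n - F 1) + S) + θ n * (F n - H n) := by linarith
      _ = θ n * (K - (H n - F 1) + S) := by ring
      _ ≤ θ n * (K - (F (n + 1) - F 1) + (S + q (n + 1))) :=
          mul_le_mul_of_nonneg_left (by linarith) h7
      _ ≤ _ := mul_le_mul_of_nonneg_right h6 (by linarith)

/-- By induction: the increment of `t ^ κ` from `n` to `n + 1` dominates `κ (n + 1) ^ (κ - 1)`,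
which is Bernoulli's inequality for exponents in `[0, 1]` at `-1 / (n + 1)`. -/
theorem sum_rpow_sub_one_le {κ : ℝ} (h0 : 0 < κ) (h1 : κ ≤ 1) (T : ℕ) :
    ∑ t ∈ Finset.Icc 1 T, (t : ℝ) ^ (κ - 1) ≤ (T : ℝ) ^ κ / κ := by
  induction T with
  | zero => simp; positivity
  | succ n ih =>
    rw [Finset.sum_Icc_succ_top (by omega)]
    have hn : (0 : ℝ) < ((n + 1 : ℕ) : ℝ) := by positivity
    have h2 := rpow_one_add_le_one_add_mul_self (s := -(1 / ((n + 1 : ℕ) : ℝ)))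
      (by
        rw [neg_le_neg_iff, div_le_one hn]
        push_cast; linarith [(Nat.cast_nonneg n : (0 : ℝ) ≤ n)]) h0.le h1
    have h3 : 1 + -(1 / ((n + 1 : ℕ) : ℝ)) = (n : ℝ) / ((n + 1 : ℕ) : ℝ) := by
      field_simp; push_cast; ring
    rw [h3, Real.div_rpow (Nat.cast_nonneg n) hn.le, div_le_iff₀ (by positivity)] at h2
    have h4 : ((n + 1 : ℕ) : ℝ) ^ (κ - 1) = ((n + 1 : ℕ) : ℝ) ^ κ / ((n + 1 : ℕ) : ℝ) :=
      Real.rpow_sub_one hn.ne' κ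
    have h5 : (n : ℝ) ^ κ + κ * ((n + 1 : ℕ) : ℝ) ^ (κ - 1) ≤ ((n + 1 : ℕ) : ℝ) ^ κ := by
      rw [h4]
      have : (1 + κ * -(1 / ((n + 1 : ℕ) : ℝ))) * ((n + 1 : ℕ) : ℝ) ^ κ
        = ((n + 1 : ℕ) : ℝ) ^ κ - κ * (((n + 1 : ℕ) : ℝ) ^ κ / ((n + 1 : ℕ) : ℝ)) := by ring
      linarith
    calc _ ≤ (n : ℝ) ^ κ / κ + ((n + 1 : ℕ) : ℝ) ^ (κ - 1) := by linarith
      _ = ((n : ℝ) ^ κ + κ * ((n + 1 : ℕ) : ℝ) ^ (κ - 1)) / κ := by field_simp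
      _ ≤ _ := by gcongr

variable {a b κ : ℝ}

/-- The offset `b` may be negative; the slope `min a (a + b)` serves both signs. -/
theorem min_mul_le {t : ℕ} (ht : 1 ≤ t) : min a (a + b) * t ≤ a * t + b := by
  have ht' : (1 : ℝ) ≤ t := by exact_mod_cast ht
  rcases le_total 0 b with hb | hb
  · rw [min_eq_left (by linarith)]
    linarith
  · rw [min_eq_right (by linarith)]
    nlinarith

theorem affine_pos (ha : 0 < a) (hab : 0 < a + b) {t : ℕ} (ht : 1 ≤ t) : 0 < a * t + b := by
  have ht' : (1 : ℝ) ≤ t := by exact_mod_cast ht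
  nlinarith

theorem stepSize_pos (ha : 0 < a) (hab : 0 < a + b) {t : ℕ} (ht : 1 ≤ t) :
    0 < stepSize a b κ t :=
  one_div_pos.2 (Real.rpow_pos_of_pos (affine_pos ha hab ht) _)

theorem inv_stepSize_mono (ha : 0 < a) (hab : 0 < a + b) (hκ : 0 ≤ κ) {t : ℕ} (ht : 1 ≤ t) :
    (stepSize a b κ t)⁻¹ ≤ (stepSize a b κ (t + 1))⁻¹ := by
  simp only [stepSize, one_div, inv_inv]
  have := affine_pos ha hab ht
  gcongr
  omega

theorem inv_stepSize_le (ha : 0 < a) (hab : 0 < a + b) (hκ : 0 ≤ κ) {t : ℕ} (ht : 1 ≤ t) :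
    (stepSize a b κ t)⁻¹ ≤ (a + |b|) ^ κ * (t : ℝ) ^ κ := by
  simp only [stepSize, one_div, inv_inv]
  have := affine_pos ha hab ht
  have ht' : (1 : ℝ) ≤ t := by exact_mod_cast ht
  rw [← Real.mul_rpow (by positivity) (by positivity)]
  gcongr
  nlinarith [le_abs_self b, abs_nonneg b]

theorem stepSize_le (ha : 0 < a) (hab : 0 < a + b) (hκ : 0 ≤ κ) {t : ℕ} (ht : 1 ≤ t) :
    stepSize a b κ t ≤ (min a (a + b)) ^ (-κ) * (t : ℝ) ^ (-κ) := by
  have hc : 0 < min a (a + b) := lt_min ha hab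
  have ht' : (0 : ℝ) < t := by exact_mod_cast ht
  rw [← Real.mul_rpow hc.le ht'.le, Real.rpow_neg (by positivity), stepSize, one_div]
  gcongr
  exact min_mul_le ht

end Sums

/-! ### Exponential moments of sums of bounded variables with small conditional drift -/

section Exponential

variable {Ω : Type*} {m0 : MeasurableSpace Ω} {μ : Measure Ω}

/-- One step of the exponential-moment recursion, from `exp x ≤ 1 + x + x ^ 2` for `|x| ≤ 1` and
then `1 + x ≤ exp x`. The hypothesis `hβ` is a conditional drift bound tested only against the
weight `Z`, the form in which it is later supplied. -/
theorem integral_mul_exp_le {Z y : Ω → ℝ} {s K β : ℝ} (hs : 0 ≤ s) (hZ : Integrable Z μ)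
    (hZ0 : ∀ ω, 0 ≤ Z ω) (hy : AEStronglyMeasurable y μ) (hyK : ∀ᵐ ω ∂μ, |y ω| ≤ K)
    (hsK : s * K ≤ 1) (hβ : ∫ ω, Z ω * y ω ∂μ ≤ β * ∫ ω, Z ω ∂μ) :
    ∫ ω, Z ω * Real.exp (s * y ω) ∂μ ≤ Real.exp (s * β + s ^ 2 * K ^ 2) * ∫ ω, Z ω ∂μ := by
  have hZy : Integrable (fun ω => Z ω * y ω) μ :=
    hZ.mul_bdd hy (hyK.mono fun ω h => by rwa [Real.norm_eq_abs])
  have hpt : ∀ᵐ ω ∂μ, Z ω * Real.exp (s * y ω)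
      ≤ (1 + s ^ 2 * K ^ 2) * Z ω + s * (Z ω * y ω) := by
    filter_upwards [hyK] with ω hω
    have h1 : |s * y ω| ≤ 1 := by
      rw [abs_mul, abs_of_nonneg hs]
      exact (mul_le_mul_of_nonneg_left hω hs).trans hsK
    have h2 := (abs_le.1 (Real.abs_exp_sub_one_sub_id_le h1)).2
    have h3 : (s * y ω) ^ 2 ≤ s ^ 2 * K ^ 2 := by
      rw [mul_pow]
      exact mul_le_mul_of_nonneg_left (sq_le_sq' (abs_le.1 hω).1 (abs_le.1 hω).2) (sq_nonneg s)
    have h4 : Real.exp (s * y ω) ≤ 1 + s ^ 2 * K ^ 2 + s * y ω := by linarith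
    calc Z ω * Real.exp (s * y ω) ≤ Z ω * (1 + s ^ 2 * K ^ 2 + s * y ω) :=
          mul_le_mul_of_nonneg_left h4 (hZ0 ω)
      _ = _ := by ring
  have hI : 0 ≤ ∫ ω, Z ω ∂μ := integral_nonneg hZ0
  calc ∫ ω, Z ω * Real.exp (s * y ω) ∂μ
      ≤ ∫ ω, ((1 + s ^ 2 * K ^ 2) * Z ω + s * (Z ω * y ω)) ∂μ :=
        integral_mono_of_nonneg
          (Filter.Eventually.of_forall fun ω => mul_nonneg (hZ0 ω) (Real.exp_nonneg _))
          ((hZ.const_mul _).add (hZy.const_mul _)) hpt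
    _ = (1 + s ^ 2 * K ^ 2) * ∫ ω, Z ω ∂μ + s * ∫ ω, Z ω * y ω ∂μ := by
        rw [integral_add (hZ.const_mul _) (hZy.const_mul _), integral_const_mul,
          integral_const_mul]
    _ ≤ (s * β + s ^ 2 * K ^ 2 + 1) * ∫ ω, Z ω ∂μ := by
        have := mul_le_mul_of_nonneg_left hβ hs
        linarith
    _ ≤ _ := mul_le_mul_of_nonneg_right (Real.add_one_le_exp _) hI

theorem ae_abs_sum_le {y : ℕ → Ω → ℝ} {K : ℕ → ℝ} {T : ℕ}
    (hyK : ∀ t, 1 ≤ t → t < T → ∀ᵐ ω ∂μ, |y t ω| ≤ K t) {n : ℕ} (hn : n ≤ T) :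
    ∀ᵐ ω ∂μ, |∑ t ∈ Finset.Ico 1 n, y t ω| ≤ ∑ t ∈ Finset.Ico 1 n, K t := by
  have h : ∀ᵐ ω ∂μ, ∀ t ∈ Finset.Ico 1 n, |y t ω| ≤ K t := by
    rw [Finset.eventually_all]
    intro t ht
    rw [Finset.mem_Ico] at ht
    exact hyK t ht.1 (by omega)
  filter_upwards [h] with ω hω
  exact (Finset.abs_sum_le_sum_abs _ _).trans (Finset.sum_le_sum hω)

theorem ae_exp_sum_le {y : ℕ → Ω → ℝ} {K : ℕ → ℝ} {s : ℝ} {T : ℕ} (hs : 0 ≤ s)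
    (hyK : ∀ t, 1 ≤ t → t < T → ∀ᵐ ω ∂μ, |y t ω| ≤ K t) {n : ℕ} (hn : n ≤ T) :
    ∀ᵐ ω ∂μ, Real.exp (s * ∑ t ∈ Finset.Ico 1 n, y t ω)
      ≤ Real.exp (s * ∑ t ∈ Finset.Ico 1 n, K t) := by
  filter_upwards [ae_abs_sum_le hyK hn] with ω hω
  exact Real.exp_le_exp.2 (mul_le_mul_of_nonneg_left ((le_abs_self _).trans hω) hs)

theorem measurable_exp_sum {m : MeasurableSpace Ω} {y : ℕ → Ω → ℝ} {s : ℝ} {n : ℕ}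
    (hy : ∀ t, 1 ≤ t → t < n → Measurable[m] (y t)) :
    Measurable[m] fun ω => Real.exp (s * ∑ t ∈ Finset.Ico 1 n, y t ω) := by
  refine Real.measurable_exp.comp (Measurable.const_mul ?_ s)
  refine Finset.measurable_fun_sum _ fun t ht => ?_
  rw [Finset.mem_Ico] at ht
  exact hy t ht.1 ht.2

variable [IsProbabilityMeasure μ]

theorem integrable_exp_sum {y : ℕ → Ω → ℝ} {K : ℕ → ℝ} {s : ℝ} {T : ℕ} (hs : 0 ≤ s)
    (hy : ∀ t, 1 ≤ t → t < T → Measurable (y t))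
    (hyK : ∀ t, 1 ≤ t → t < T → ∀ᵐ ω ∂μ, |y t ω| ≤ K t) {n : ℕ} (hn : n ≤ T) :
    Integrable (fun ω => Real.exp (s * ∑ t ∈ Finset.Ico 1 n, y t ω)) μ := by
  refine Integrable.of_bound
    (measurable_exp_sum fun t h1 h2 => hy t h1 (by omega)).aestronglyMeasurable
    (Real.exp (s * ∑ t ∈ Finset.Ico 1 n, K t)) ?_
  filter_upwards [ae_exp_sum_le hs hyK hn] with ω hω
  rwa [Real.norm_of_nonneg (Real.exp_nonneg _)]

theorem integral_exp_sum_le {y : ℕ → Ω → ℝ} {K β : ℕ → ℝ} {s : ℝ} {T : ℕ} (hs : 0 ≤ s)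
    (hy : ∀ t, 1 ≤ t → t < T → Measurable (y t))
    (hyK : ∀ t, 1 ≤ t → t < T → ∀ᵐ ω ∂μ, |y t ω| ≤ K t)
    (hsK : ∀ t, 1 ≤ t → t < T → s * K t ≤ 1)
    (hβ : ∀ t, 1 ≤ t → t < T →
      ∫ ω, Real.exp (s * ∑ r ∈ Finset.Ico 1 t, y r ω) * y t ω ∂μ
        ≤ β t * ∫ ω, Real.exp (s * ∑ r ∈ Finset.Ico 1 t, y r ω) ∂μ)
    {n : ℕ} (hn : 1 ≤ n) (hnT : n ≤ T) :
    ∫ ω, Real.exp (s * ∑ t ∈ Finset.Ico 1 n, y t ω) ∂μ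
      ≤ Real.exp (∑ t ∈ Finset.Ico 1 n, (s * β t + s ^ 2 * K t ^ 2)) := by
  induction n, hn using Nat.le_induction with
  | base => simp
  | succ n hn ih =>
    have h1 := integral_mul_exp_le hs (integrable_exp_sum hs hy hyK (n := n) (by omega))
      (fun ω => Real.exp_nonneg _) (hy n hn (by omega)).aestronglyMeasurable
      (hyK n hn (by omega)) (hsK n hn (by omega)) (hβ n hn (by omega))
    simp only [Finset.sum_Ico_succ_top hn, mul_add, Real.exp_add] at h1 ⊢
    refine h1.trans ?_
    rw [mul_comm]
    exact mul_le_mul_of_nonneg_right (ih (by omega)) (by positivity)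

/-- An Azuma–Hoeffding type tail bound. -/
theorem measure_sum_ge_le {y : ℕ → Ω → ℝ} {K β : ℕ → ℝ} {s : ℝ} {T : ℕ} (hs : 0 < s)
    (hT : 1 ≤ T)
    (hy : ∀ t, 1 ≤ t → t < T → Measurable (y t))
    (hyK : ∀ t, 1 ≤ t → t < T → ∀ᵐ ω ∂μ, |y t ω| ≤ K t)
    (hsK : ∀ t, 1 ≤ t → t < T → s * K t ≤ 1)
    (hβ : ∀ t, 1 ≤ t → t < T →
      ∫ ω, Real.exp (s * ∑ r ∈ Finset.Ico 1 t, y r ω) * y t ω ∂μ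
        ≤ β t * ∫ ω, Real.exp (s * ∑ r ∈ Finset.Ico 1 t, y r ω) ∂μ)
    {δ : ℝ} (hδ : 0 < δ) :
    μ.real {ω | ∑ t ∈ Finset.Ico 1 T, β t + s * ∑ t ∈ Finset.Ico 1 T, K t ^ 2
      + Real.log (1 / δ) / s ≤ ∑ t ∈ Finset.Ico 1 T, y t ω} ≤ δ := by
  have h1 := integral_exp_sum_le hs.le hy hyK hsK hβ hT le_rfl
  have h2 := measure_ge_le_exp_mul_mgf (μ := μ) (X := fun ω => ∑ t ∈ Finset.Ico 1 T, y t ω)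
    (∑ t ∈ Finset.Ico 1 T, β t + s * ∑ t ∈ Finset.Ico 1 T, K t ^ 2 + Real.log (1 / δ) / s)
    hs.le (integrable_exp_sum hs.le hy hyK le_rfl)
  refine h2.trans ((mul_le_mul_of_nonneg_left h1 (Real.exp_nonneg _)).trans ?_)
  rw [← Real.exp_add, Finset.sum_add_distrib, ← Finset.mul_sum, ← Finset.mul_sum, one_div,
    Real.log_inv]
  -- The threshold is chosen so that the Chernoff exponent is exactly `log δ`.
  have h3 : -s * (∑ t ∈ Finset.Ico 1 T, β t + s * ∑ t ∈ Finset.Ico 1 T, K t ^ 2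
      + -Real.log δ / s) + (s * ∑ t ∈ Finset.Ico 1 T, β t + s ^ 2 * ∑ t ∈ Finset.Ico 1 T, K t ^ 2)
      = Real.log δ := by
    field_simp
    ring
  rw [h3, Real.exp_log hδ]

end Exponential

/-! ### The conditional drift of clipped gradients -/

section Drift

variable {Ω : Type*} {m m0 : MeasurableSpace Ω} {μ : Measure Ω} [IsProbabilityMeasure μ] {d : ℕ}

/-- The vector `Z • u` is bounded and known given `m`, so it pulls out of the conditional
expectation and unbiasedness cancels the rest. -/
theorem integral_mul_inner_sub_eq_zero (hm : m ≤ m0) {Z : Ω → ℝ} {u G γ : Ω → Vec d} {C U : ℝ}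
    (hZ : Measurable[m] Z) (hu : Measurable[m] u) (hZC : ∀ᵐ ω ∂μ, |Z ω| ≤ C)
    (huU : ∀ᵐ ω ∂μ, ‖u ω‖ ≤ U) (hG : Integrable G μ) (hγ : μ[G | m] =ᵐ[μ] γ) :
    Integrable (fun ω => Z ω * inner ℝ (u ω) (γ ω - G ω)) μ ∧
      ∫ ω, Z ω * inner ℝ (u ω) (γ ω - G ω) ∂μ = 0 := by
  have hv : Measurable[m] fun ω => Z ω • u ω := hZ.smul hu
  have hvb : ∀ᵐ ω ∂μ, ‖Z ω • u ω‖ ≤ C * U := by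
    filter_upwards [hZC, huU] with ω h1 h2
    rw [norm_smul, Real.norm_eq_abs]
    exact mul_le_mul h1 h2 (norm_nonneg _) ((abs_nonneg _).trans h1)
  have hγi : Integrable γ μ := integrable_condExp.congr hγ
  have hi : ∀ {F : Ω → Vec d}, Integrable F μ →
      Integrable (fun ω => inner ℝ (Z ω • u ω) (F ω)) μ := fun hF =>
    (innerSL ℝ).integrable_of_bilin_of_bdd_left (C * U)
      (hv.mono hm le_rfl).aestronglyMeasurable hvb hF
  have hvs : StronglyMeasurable[m] fun ω => Z ω • u ω := hv.stronglyMeasurable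
  have hpull : μ[fun ω => inner ℝ (Z ω • u ω) (G ω) | m]
      =ᵐ[μ] fun ω => inner ℝ (Z ω • u ω) (μ[G | m] ω) :=
    condExp_stronglyMeasurable_bilin_of_bound (innerSL ℝ) hm hvs hG (C * U) hvb
  have heq : ∀ ω, Z ω * inner ℝ (u ω) (γ ω - G ω)
      = inner ℝ (Z ω • u ω) (γ ω) - inner ℝ (Z ω • u ω) (G ω) := by
    intro ω
    rw [inner_sub_right, real_inner_smul_left, real_inner_smul_left, mul_sub]
  simp only [heq]
  refine ⟨(hi hγi).sub (hi hG), ?_⟩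
  rw [integral_sub (hi hγi) (hi hG), sub_eq_zero]
  rw [← integral_condExp (f := fun ω => inner ℝ (Z ω • u ω) (G ω)) hm]
  refine integral_congr_ae ?_
  filter_upwards [hγ, hpull] with ω h2 h3
  rw [h3, h2]

theorem integral_mul_le_of_condExp_le (hm : m ≤ m0) {Z n : Ω → ℝ} {C c : ℝ}
    (hZ : Measurable[m] Z) (hZ0 : ∀ ω, 0 ≤ Z ω) (hZC : ∀ᵐ ω ∂μ, |Z ω| ≤ C)
    (hn : Integrable n μ) (hc : μ[n | m] ≤ᵐ[μ] fun _ => c) :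
    Integrable (fun ω => Z ω * n ω) μ ∧ ∫ ω, Z ω * n ω ∂μ ≤ c * ∫ ω, Z ω ∂μ := by
  have hZm : AEStronglyMeasurable Z μ := (hZ.mono hm le_rfl).aestronglyMeasurable
  have hZs : StronglyMeasurable[m] Z := hZ.stronglyMeasurable
  have hZi : Integrable Z μ := Integrable.of_bound hZm C hZC
  have hi : ∀ {F : Ω → ℝ}, Integrable F μ → Integrable (fun ω => Z ω * F ω) μ := fun hF =>
    hF.bdd_mul hZm hZC
  refine ⟨hi hn, ?_⟩
  have hpull : μ[fun ω => Z ω * n ω | m] =ᵐ[μ] fun ω => Z ω * μ[n | m] ω :=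
    condExp_mul_of_stronglyMeasurable_left hZs (hi hn) hn
  rw [← integral_condExp hm, integral_congr_ae hpull, ← integral_const_mul]
  refine integral_mono_ae (hi integrable_condExp) (hZi.const_mul c) ?_
  filter_upwards [hc] with ω hω
  rw [mul_comm c]
  exact mul_le_mul_of_nonneg_left hω (hZ0 ω)

/-- The clipped gradients of an unbiased estimator with bounded conditional `p`-th moment have a
small conditional drift. -/
theorem integral_mul_inner_sub_clip_le (hm : m ≤ m0) {Z : Ω → ℝ} {u G γ : Ω → Vec d}
    {C U lam p c : ℝ} (hlam : 0 < lam) (hp : 1 < p) (hU : 0 ≤ U)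
    (hZ : Measurable[m] Z) (hZ0 : ∀ ω, 0 ≤ Z ω) (hZC : ∀ᵐ ω ∂μ, |Z ω| ≤ C)
    (hu : Measurable[m] u) (huU : ∀ᵐ ω ∂μ, ‖u ω‖ ≤ U) (hG : Integrable G μ)
    (hγ : μ[G | m] =ᵐ[μ] γ) (hγb : ∀ᵐ ω ∂μ, ‖γ ω‖ ≤ lam / 2)
    (hn : Integrable (fun ω => ‖G ω - γ ω‖ ^ p) μ)
    (hc : μ[fun ω => ‖G ω - γ ω‖ ^ p | m] ≤ᵐ[μ] fun _ => c) :
    Integrable (fun ω => Z ω * inner ℝ (u ω) (γ ω - clip lam (G ω))) μ ∧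
      ∫ ω, Z ω * inner ℝ (u ω) (γ ω - clip lam (G ω)) ∂μ
        ≤ U * (lam / 2) ^ (1 - p) * c * ∫ ω, Z ω ∂μ := by
  obtain ⟨hi1, h1⟩ := integral_mul_inner_sub_eq_zero hm hZ hu hZC huU hG hγ
  obtain ⟨hi2, h2⟩ := integral_mul_le_of_condExp_le hm hZ hZ0 hZC hn hc
  have hU2 : 0 ≤ U * (lam / 2) ^ (1 - p) := by positivity
  have hb : ∀ᵐ ω ∂μ, |Z ω * inner ℝ (u ω) (G ω - clip lam (G ω))|
      ≤ U * (lam / 2) ^ (1 - p) * (Z ω * ‖G ω - γ ω‖ ^ p) := by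
    filter_upwards [huU, hγb] with ω hω1 hω2
    rw [abs_mul, abs_of_nonneg (hZ0 ω)]
    calc Z ω * |inner ℝ (u ω) (G ω - clip lam (G ω))|
        ≤ Z ω * (U * ((lam / 2) ^ (1 - p) * ‖G ω - γ ω‖ ^ p)) := by
          refine mul_le_mul_of_nonneg_left ((abs_real_inner_le_norm _ _).trans ?_) (hZ0 ω)
          exact mul_le_mul hω1 (norm_sub_clip_le hlam hp hω2 _) (norm_nonneg _) hU
      _ = _ := by ring
  have hm2 : AEStronglyMeasurable (fun ω => Z ω * inner ℝ (u ω) (G ω - clip lam (G ω))) μ := by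
    refine (hZ.mono hm le_rfl).aestronglyMeasurable.mul ?_
    refine AEStronglyMeasurable.inner (hu.mono hm le_rfl).aestronglyMeasurable
      (hG.aestronglyMeasurable.sub ?_)
    exact (measurable_clip.comp_aemeasurable hG.aemeasurable).aestronglyMeasurable
  have hi3 : Integrable (fun ω => Z ω * inner ℝ (u ω) (G ω - clip lam (G ω))) μ :=
    (hi2.const_mul (U * (lam / 2) ^ (1 - p))).mono' hm2 hb
  -- Split into centred noise, which integrates to zero, and clipping bias, which the `p`-th moment
  -- controls.
  have heq : ∀ ω, Z ω * inner ℝ (u ω) (γ ω - clip lam (G ω))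
      = Z ω * inner ℝ (u ω) (γ ω - G ω) + Z ω * inner ℝ (u ω) (G ω - clip lam (G ω)) := by
    intro ω
    rw [← mul_add, ← inner_add_right, sub_add_sub_cancel]
  simp only [heq]
  refine ⟨hi1.add hi3, ?_⟩
  rw [integral_add hi1 hi3, h1, zero_add]
  calc ∫ ω, Z ω * inner ℝ (u ω) (G ω - clip lam (G ω)) ∂μ
      ≤ ∫ ω, U * (lam / 2) ^ (1 - p) * (Z ω * ‖G ω - γ ω‖ ^ p) ∂μ :=
        integral_mono_ae hi3 (hi2.const_mul _) (hb.mono fun ω h => (le_abs_self _).trans h)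
    _ ≤ U * (lam / 2) ^ (1 - p) * (c * ∫ ω, Z ω ∂μ) := by
        rw [integral_const_mul]
        exact mul_le_mul_of_nonneg_left h2 hU2
    _ = _ := by ring

end Drift

/-! ### Measurability with respect to the history -/

section History

variable {N d : ℕ} {Ω : Type*} {x₁ : Fin N → Ω → Vec d} {G : Fin N → ℕ → Ω → Vec d}

theorem history_le [m0 : MeasurableSpace Ω] {t : ℕ} (hx : ∀ i, Measurable (x₁ i))
    (hG : ∀ i s, 1 ≤ s → s < t → Measurable (G i s)) : history x₁ G t ≤ m0 := by
  refine sup_le (iSup_le fun i => (hx i).comap_le) (iSup₂_le fun s hs => iSup_le fun i => ?_)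
  rw [Finset.mem_Ico] at hs
  exact (hG i s hs.1 hs.2).comap_le

theorem measurable_history_init (t : ℕ) (i : Fin N) : Measurable[history x₁ G t] (x₁ i) :=
  Measurable.mono (comap_measurable _)
    ((le_iSup (fun j => MeasurableSpace.comap (x₁ j) inferInstance) i).trans le_sup_left) le_rfl

theorem measurable_history_gradient {s t : ℕ} (hs : 1 ≤ s) (hst : s < t) (i : Fin N) :
    Measurable[history x₁ G t] (G i s) := by
  refine Measurable.mono (comap_measurable _) (le_trans ?_ le_sup_right) le_rfl
  refine le_trans ?_ (le_iSup₂ s (Finset.mem_Ico.2 ⟨hs, hst⟩))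
  exact le_iSup (fun j => MeasurableSpace.comap (G j s) inferInstance) i

theorem randomStates_succ {W : ℕ → Matrix (Fin N) (Fin N) ℝ} {η lam : ℕ → ℝ}
    {g : Fin N → ℕ → Ω → Vec d → Vec d} {X : ℕ → Fin N → Ω → Vec d}
    (hX : X = randomStates W η lam x₁ g) (hG : G = observed g X) {t : ℕ} (ht : 1 ≤ t) (i : Fin N)
    (ω : Ω) :
    X (t + 1) i ω = ∑ j, W t i j • X t j ω - η t • clip (lam t) (G i t ω) := by
  obtain ⟨r, rfl⟩ : ∃ r, t = r + 1 := ⟨t - 1, by omega⟩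
  rw [hG, hX]
  rfl

/-- The state at time `s` uses only gradients observed strictly before `s`, so it is known before
those of time `t ≥ s` are. -/
theorem measurable_history_states {W : ℕ → Matrix (Fin N) (Fin N) ℝ} {η lam : ℕ → ℝ}
    {g : Fin N → ℕ → Ω → Vec d → Vec d} {X : ℕ → Fin N → Ω → Vec d}
    (hX : X = randomStates W η lam x₁ g) (hG : G = observed g X) {s t : ℕ} (hs : 1 ≤ s)
    (hst : s ≤ t) (i : Fin N) : Measurable[history x₁ G t] (X s i) := by
  induction s, hs using Nat.le_induction generalizing i with
  | base =>
    have : X 1 i = x₁ i := by rw [hX]; rfl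
    rw [this]
    exact measurable_history_init t i
  | succ s hs ih =>
    rw [funext (randomStates_succ hX hG hs i)]
    have h2 := fun j => ih (by omega) j
    have h3 := measurable_history_gradient (x₁ := x₁) (G := G) hs (by omega : s < t) i
    let := history x₁ G t
    refine Measurable.sub (Finset.measurable_fun_sum _ fun j _ => ?_) ?_
    · exact (h2 j).const_smul (W s i j)
    · exact (measurable_clip.comp h3).const_smul (η s)

end History

/-! ### One step of the algorithm -/

section Step

variable {N d : ℕ} {L : ℝ≥0} {f : Fin N → ℕ → Vec d → ℝ} {t : ℕ}

theorem average_sub (x y : Fin N → Vec d) :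
    average (fun i => x i - y i) = average x - average y := by
  simp only [average, Finset.sum_sub_distrib, smul_sub]

theorem inner_average (u : Vec d) (x : Fin N → Vec d) :
    inner ℝ u (average x) = (N : ℝ)⁻¹ * ∑ i, inner ℝ u (x i) := by
  rw [average, real_inner_smul_right, inner_sum]

/-- The averages perform gradient descent with the averages of the clipped gradients. -/
theorem average_step {W : Matrix (Fin N) (Fin N) ℝ} (hW : ∀ j, ∑ i, W i j = 1) {η : ℝ}
    {x x' c : Fin N → Vec d} (hx : ∀ i, x' i = ∑ j, W i j • x j - η • c i) :
    average x' = average x - η • average c := by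
  have h : average x' = average (fun i => (∑ j, W i j • x j) - η • c i) :=
    congrArg average (funext hx)
  rw [h, average_sub]
  congr 1
  · rw [average, average, Finset.sum_comm]
    simp only [← Finset.sum_smul, hW, one_smul]
  · rw [average, average, ← Finset.smul_sum, smul_comm]

/-- The inner product of the global gradient at the average state with the mean deviation of the
clipped gradients `c` from the local gradients. -/
def clipError (f : Fin N → ℕ → Vec d → ℝ) (t : ℕ) (x c : Fin N → Vec d) : ℝ :=
  inner ℝ (gradient (globalCost f t) (average x))
    (average fun i => gradient (f i t) (x i) - c i)

theorem norm_gradient_globalCost_le (hf : ∀ i, LSmooth L (f i t)) {z : Vec d} {Bg : ℝ}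
    (hg : ∀ i, ‖gradient (f i t) z‖ ≤ Bg) : ‖gradient (globalCost f t) z‖ ≤ N * Bg := by
  rw [gradient_globalCost fun i => (hf i).1]
  exact (norm_sum_le _ _).trans ((Finset.sum_le_sum fun i _ => hg i).trans_eq (by simp))

/-- The descent inequality at the mean state, divided by `η`. Its four terms are the consensus
error, the clipping error, the decrease of cost and the second-order remainder. -/
theorem sq_norm_gradient_le (hN : 1 ≤ N) (hf : ∀ i, LSmooth L (f i t)) {x c : Fin N → Vec d}
    {η lam Bg : ℝ} (hη : 0 < η) (hlam : 0 ≤ lam) (hc : ∀ i, ‖c i‖ ≤ lam)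
    (hg : ∀ i, ‖gradient (f i t) (average x)‖ ≤ Bg) :
    (N : ℝ)⁻¹ * ‖gradient (globalCost f t) (average x)‖ ^ 2
      ≤ N * Bg * L * spread x + clipError f t x c
        + η⁻¹ * (globalCost f t (average x) - globalCost f t (average x - η • average c))
        + N * L * (η * lam ^ 2) := by
  have hN0 : (N : ℝ) ≠ 0 := by positivity
  set u := gradient (globalCost f t) (average x) with hu
  have h1 : average c = (N : ℝ)⁻¹ • u
      + average (fun i => gradient (f i t) (x i) - gradient (f i t) (average x))
      - average (fun i => gradient (f i t) (x i) - c i) := by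
    have : (N : ℝ)⁻¹ • u = average (fun i => gradient (f i t) (average x)) := by
      rw [hu, gradient_globalCost fun i => (hf i).1]
      rfl
    rw [this, average_sub, average_sub]
    abel
  have h2 : ‖average (fun i => gradient (f i t) (x i) - gradient (f i t) (average x))‖
      ≤ L * spread x :=
    norm_average_le (mul_nonneg L.2 (spread_nonneg x)) fun i =>
      ((hf i).2.norm_sub_le _ _).trans
        (mul_le_mul_of_nonneg_left (norm_sub_average_le_spread x i) L.2)
  have h3 : -(N * Bg * (L * spread x))
      ≤ inner ℝ u (average (fun i => gradient (f i t) (x i) - gradient (f i t) (average x))) := by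
    refine (abs_le.1 ((abs_real_inner_le_norm _ _).trans ?_)).1
    exact mul_le_mul (norm_gradient_globalCost_le hf hg) h2 (norm_nonneg _)
      ((norm_nonneg _).trans (norm_gradient_globalCost_le hf hg))
  have h4 : inner ℝ u (average c) = (N : ℝ)⁻¹ * ‖u‖ ^ 2
      + inner ℝ u (average (fun i => gradient (f i t) (x i) - gradient (f i t) (average x)))
      - clipError f t x c := by
    rw [h1, inner_sub_right, inner_add_right, real_inner_smul_right, real_inner_self_eq_norm_sq,
      clipError]
  have h5 := (abs_le.1 ((LSmooth.globalCost hf).abs_sub_sub_inner_le (average x)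
    (average x - η • average c))).2
  rw [sub_sub_cancel_left, inner_neg_right, real_inner_smul_right, norm_neg, norm_smul,
    Real.norm_of_nonneg hη.le, ← hu, NNReal.coe_mul, NNReal.coe_natCast] at h5
  have h6 : (N : ℝ) * L * (η * ‖average c‖) ^ 2 ≤ N * L * (η * lam) ^ 2 := by
    have := norm_average_le hlam hc
    gcongr
  have h7 : inner ℝ u (average c)
      ≤ η⁻¹ * (globalCost f t (average x) - globalCost f t (average x - η • average c))
        + N * L * (η * lam ^ 2) := by
    have h8 : η * inner ℝ u (average c)
        ≤ (globalCost f t (average x) - globalCost f t (average x - η • average c))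
          + N * L * (η * lam) ^ 2 := by linarith
    calc inner ℝ u (average c) = η⁻¹ * (η * inner ℝ u (average c)) := by field_simp
      _ ≤ η⁻¹ * ((globalCost f t (average x) - globalCost f t (average x - η • average c))
          + N * L * (η * lam) ^ 2) := by gcongr
      _ = _ := by field_simp
  linarith

/-- Lipschitz gradients give an error quadratic in the spread; `spread x ≤ 2 * BX` makes it linear,
so that the summed spread suffices. -/
theorem sum_sq_norm_gradient_le (hf : ∀ i, LSmooth L (f i t)) {x : Fin N → Vec d} {BX : ℝ}
    (hx : ∀ i, ‖x i‖ ≤ BX) :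
    ∑ i, ‖gradient (globalCost f t) (x i)‖ ^ 2
      ≤ 2 * N * ‖gradient (globalCost f t) (average x)‖ ^ 2
        + 4 * N * (N * L) ^ 2 * BX * spread x := by
  set u := gradient (globalCost f t) (average x)
  have hNL : (0 : ℝ) ≤ N * L := by positivity
  have h1 : ∀ i, ‖gradient (globalCost f t) (x i)‖ ^ 2
      ≤ 2 * ‖u‖ ^ 2 + 4 * (N * L) ^ 2 * BX * spread x := by
    intro i
    have hBX : 0 ≤ BX := (norm_nonneg _).trans (hx i)
    have h2 : ‖gradient (globalCost f t) (x i) - u‖ ≤ N * L * spread x := by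
      refine ((LSmooth.globalCost hf).2.norm_sub_le _ _).trans ?_
      rw [NNReal.coe_mul, NNReal.coe_natCast]
      exact mul_le_mul_of_nonneg_left (norm_sub_average_le_spread x i) hNL
    have h3 : spread x ≤ 2 * BX := spread_le (by linarith) fun i j =>
      (norm_sub_le _ _).trans (by linarith [hx i, hx j])
    have h4 : ‖gradient (globalCost f t) (x i)‖ ≤ ‖u‖ + N * L * spread x := by
      have := norm_add_le u (gradient (globalCost f t) (x i) - u)
      rw [add_sub_cancel] at this
      linarith
    have h5 := spread_nonneg x
    calc ‖gradient (globalCost f t) (x i)‖ ^ 2 ≤ (‖u‖ + N * L * spread x) ^ 2 := by gcongr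
      _ ≤ 2 * (‖u‖ ^ 2 + (N * L * spread x) ^ 2) := add_sq_le
      _ = 2 * ‖u‖ ^ 2 + 2 * (N * L) ^ 2 * (spread x * spread x) := by ring
      _ ≤ 2 * ‖u‖ ^ 2 + 2 * (N * L) ^ 2 * (2 * BX * spread x) := by gcongr
      _ = _ := by ring
  refine (Finset.sum_le_sum fun i _ => h1 i).trans_eq ?_
  rw [Finset.sum_const, Finset.card_univ, Fintype.card_fin, nsmul_eq_mul]
  ring

end Step

/-! ### The variation of the costs -/

section Variation

variable {N d : ℕ} {L : ℝ≥0} {f : Fin N → ℕ → Vec d → ℝ} {T : ℕ}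

theorem abs_globalCost_sub_le_iSup (hfin : FiniteVariation f T) {t : ℕ} (h1 : 1 ≤ t) (h2 : t < T)
    (z : Vec d) : |globalCost f (t + 1) z - globalCost f t z|
      ≤ ⨆ z, |globalCost f (t + 1) z - globalCost f (t + 1 - 1) z| :=
  le_ciSup (hfin (t + 1) (Finset.mem_Icc.2 ⟨by omega, h2⟩)) z

theorem iSup_abs_globalCost_sub_nonneg (t : ℕ) :
    0 ≤ ⨆ z, |globalCost f t z - globalCost f (t - 1) z| :=
  Real.iSup_nonneg fun _ => abs_nonneg _

theorem variation_nonneg : 0 ≤ variation f T :=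
  Finset.sum_nonneg fun t _ => iSup_abs_globalCost_sub_nonneg t

theorem abs_globalCost_sub_one_le (hfin : FiniteVariation f T) {t : ℕ} (h1 : 1 ≤ t) (h2 : t ≤ T)
    (z : Vec d) : |globalCost f t z - globalCost f 1 z| ≤ variation f T := by
  suffices h : |globalCost f t z - globalCost f 1 z|
      ≤ ∑ s ∈ Finset.Icc 2 t, ⨆ z, |globalCost f s z - globalCost f (s - 1) z| from
    h.trans (Finset.sum_le_sum_of_subset_of_nonneg (Finset.Icc_subset_Icc_right h2)
      fun s _ _ => iSup_abs_globalCost_sub_nonneg s)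
  induction t, h1 using Nat.le_induction with
  | base => simp
  | succ t ht ih =>
    rw [Finset.sum_Icc_succ_top (by omega)]
    have h3 := abs_globalCost_sub_le_iSup hfin ht (by omega) z
    have h4 := abs_sub_le (globalCost f (t + 1) z) (globalCost f t z) (globalCost f 1 z)
    linarith [ih (by omega)]

end Variation

/-! ### The regret along a trajectory -/

section Path

variable {N d : ℕ} {L : ℝ≥0} {f : Fin N → ℕ → Vec d → ℝ} {T : ℕ}

theorem nreg_le (hN : 1 ≤ N) (hT : 1 ≤ T) {x c : ℕ → Fin N → Vec d} {η lam : ℕ → ℝ}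
    {BX Bg S₀ Y₀ H₀ Θ : ℝ}
    (havg : ∀ t, 1 ≤ t → t < T → average (x (t + 1)) = average (x t) - η t • average (c t))
    (hη : ∀ t, 1 ≤ t → 0 < η t) (hη' : ∀ t, 1 ≤ t → (η t)⁻¹ ≤ (η (t + 1))⁻¹)
    (hlam : ∀ t, 0 ≤ lam t) (hc : ∀ t i, ‖c t i‖ ≤ lam t)
    (hf : ∀ i, ∀ t ∈ Finset.Icc 1 T, LSmooth L (f i t))
    (hx : ∀ t ∈ Finset.Icc 1 T, ∀ i, ‖x t i‖ ≤ BX)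
    (hg : ∀ t ∈ Finset.Icc 1 T, ∀ i, ‖gradient (f i t) (average (x t))‖ ≤ Bg)
    (hfin : FiniteVariation f T)
    (hS : ∑ t ∈ Finset.Icc 1 T, spread (x t) ≤ S₀)
    (hY : ∑ t ∈ Finset.Ico 1 T, clipError f t (x t) (c t) ≤ Y₀)
    (hH : ∑ t ∈ Finset.Ico 1 T, η t * lam t ^ 2 ≤ H₀) (hΘ : (η T)⁻¹ ≤ Θ) :
    nreg f x T ≤ 2 * N ^ 2 * (N * Bg * L * S₀ + Y₀
        + Θ * (2 * (N * Bg * (2 * BX) + N * L * (2 * BX) ^ 2) + 3 * variation f T)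
        + N * L * H₀)
      + 2 * N * (N * Bg) ^ 2 + 4 * N * (N * L) ^ 2 * BX * S₀ := by
  have hN0 : (0 : ℝ) < N := by exact_mod_cast hN
  have h1T : 1 ∈ Finset.Icc 1 T := Finset.mem_Icc.2 ⟨le_rfl, hT⟩
  have hTT : T ∈ Finset.Icc 1 T := Finset.mem_Icc.2 ⟨hT, le_rfl⟩
  have hBX : 0 ≤ BX := (norm_nonneg _).trans (hx 1 h1T ⟨0, hN⟩)
  have hBg : 0 ≤ Bg := (norm_nonneg _).trans (hg 1 h1T ⟨0, hN⟩)
  set u : ℕ → Vec d := fun t => gradient (globalCost f t) (average (x t)) with hu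
  set D := variation f T with hD
  have hD0 : 0 ≤ D := variation_nonneg
  set K₀ := (N : ℝ) * Bg * (2 * BX) + N * L * (2 * BX) ^ 2 with hK
  have hK0 : 0 ≤ K₀ := by positivity
  -- the weighted decrease of the costs
  have hdec : ∑ t ∈ Finset.Ico 1 T, (η t)⁻¹ * (globalCost f t (average (x t))
      - globalCost f t (average (x t) - η t • average (c t))) ≤ Θ * (2 * K₀ + 3 * D) := by
    have h := sum_mul_sub_le (θ := fun t => (η t)⁻¹) (F := fun t => globalCost f t (average (x t)))
      (H := fun t => globalCost f t (average (x t) - η t • average (c t)))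
      (q := fun t => ⨆ z, |globalCost f t z - globalCost f (t - 1) z|) (K := D + K₀) hT
      (fun t ht => (inv_pos.2 (hη t ht)).le) hη' ?_
      (fun t _ _ => iSup_abs_globalCost_sub_nonneg t) ?_
    · refine h.trans ?_
      calc (η T)⁻¹ * (2 * (D + K₀) + D) = (η T)⁻¹ * (2 * K₀ + 3 * D) := by ring
        _ ≤ _ := mul_le_mul_of_nonneg_right hΘ (by linarith)
    -- Exchanging `f_t` for `f_1` costs at most `D`; moving the point costs at most `K₀`, by
    -- smoothness of `f_1` and boundedness of the states.
    · intro t h1 h2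
      have htT : t ∈ Finset.Icc 1 T := Finset.mem_Icc.2 ⟨h1, h2⟩
      have h3 := abs_globalCost_sub_one_le hfin h1 h2 (average (x t))
      have hf1 : ∀ i, LSmooth L (f i 1) := fun i => hf i 1 h1T
      have h4 := (LSmooth.globalCost hf1).abs_sub_sub_inner_le (average (x 1)) (average (x t))
      rw [NNReal.coe_mul, NNReal.coe_natCast] at h4
      have h5 : ‖average (x t) - average (x 1)‖ ≤ 2 * BX :=
        (norm_sub_le _ _).trans (by
          linarith [norm_average_le hBX (hx t htT), norm_average_le hBX (hx 1 h1T)])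
      have h6 : |inner ℝ (gradient (globalCost f 1) (average (x 1)))
          (average (x t) - average (x 1))| ≤ N * Bg * (2 * BX) :=
        (abs_real_inner_le_norm _ _).trans (mul_le_mul
          (norm_gradient_globalCost_le hf1 (hg 1 h1T)) h5 (norm_nonneg _) (by positivity))
      have h7 : (N : ℝ) * L * ‖average (x t) - average (x 1)‖ ^ 2 ≤ N * L * (2 * BX) ^ 2 := by
        gcongr
      rw [abs_le] at h3 h4 h6 ⊢
      constructor <;> linarith [h3.1, h3.2, h4.1, h4.2, h6.1, h6.2]
    -- Here `H t` is `f_t` at the next mean state, so the difference is a pure change of cost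
    -- function.
    · intro t h1 h2
      rw [← havg t h1 h2]
      exact (le_abs_self _).trans (abs_globalCost_sub_le_iSup hfin h1 h2 _)
  -- the gradients at the averages
  have hmain : (N : ℝ)⁻¹ * ∑ t ∈ Finset.Ico 1 T, ‖u t‖ ^ 2
      ≤ N * Bg * L * S₀ + Y₀ + Θ * (2 * K₀ + 3 * D) + N * L * H₀ := by
    have h1 : ∑ t ∈ Finset.Ico 1 T, spread (x t) ≤ S₀ :=
      (Finset.sum_le_sum_of_subset_of_nonneg Finset.Ico_subset_Icc_self
        fun t _ _ => spread_nonneg _).trans hS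
    rw [Finset.mul_sum]
    refine (Finset.sum_le_sum fun t ht => sq_norm_gradient_le (L := L) (c := c t) hN
      (fun i => hf i t (Finset.Ico_subset_Icc_self ht)) (hη t (Finset.mem_Ico.1 ht).1)
      (hlam t) (hc t) (hg t (Finset.Ico_subset_Icc_self ht))).trans ?_
    rw [Finset.sum_add_distrib, Finset.sum_add_distrib, Finset.sum_add_distrib, ← Finset.mul_sum,
      ← Finset.mul_sum]
    have h2 : (N : ℝ) * Bg * L * ∑ t ∈ Finset.Ico 1 T, spread (x t) ≤ N * Bg * L * S₀ := by
      gcongr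
    have h3 : (N : ℝ) * L * ∑ t ∈ Finset.Ico 1 T, η t * lam t ^ 2 ≤ N * L * H₀ := by gcongr
    linarith
  have hu2 : ∑ t ∈ Finset.Ico 1 T, ‖u t‖ ^ 2
      ≤ N * (N * Bg * L * S₀ + Y₀ + Θ * (2 * K₀ + 3 * D) + N * L * H₀) :=
    (inv_mul_le_iff₀ hN0).1 hmain
  -- The states are controlled only up to `T`, so the last gradient is bounded directly instead of
  -- through a step.
  have huT : ‖u T‖ ^ 2 ≤ (N * Bg) ^ 2 := by
    have := norm_gradient_globalCost_le (fun i => hf i T hTT) (hg T hTT)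
    gcongr
  have hall : ∑ t ∈ Finset.Icc 1 T, ‖u t‖ ^ 2
      = ∑ t ∈ Finset.Ico 1 T, ‖u t‖ ^ 2 + ‖u T‖ ^ 2 := by
    rw [← Finset.sum_Ico_succ_top hT]
    rfl
  calc nreg f x T ≤ ∑ t ∈ Finset.Icc 1 T,
        (2 * N * ‖u t‖ ^ 2 + 4 * N * (N * L) ^ 2 * BX * spread (x t)) :=
        Finset.sum_le_sum fun t ht => sum_sq_norm_gradient_le (fun i => hf i t ht) (hx t ht)
    _ = 2 * N * (∑ t ∈ Finset.Ico 1 T, ‖u t‖ ^ 2 + ‖u T‖ ^ 2)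
        + 4 * N * (N * L) ^ 2 * BX * ∑ t ∈ Finset.Icc 1 T, spread (x t) := by
        rw [Finset.sum_add_distrib, ← Finset.mul_sum, ← Finset.mul_sum, hall]
    _ ≤ 2 * N * (N * (N * Bg * L * S₀ + Y₀ + Θ * (2 * K₀ + 3 * D) + N * L * H₀)
          + (N * Bg) ^ 2) + 4 * N * (N * L) ^ 2 * BX * S₀ := by gcongr
    _ = _ := by ring

end Path

/-! ### The tail of the clipping errors -/

section Tail

variable {N d : ℕ} {Ω : Type*} {L : ℝ≥0} {f : Fin N → ℕ → Vec d → ℝ}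

theorem LSmooth.measurable_gradient {h : Vec d → ℝ} (hh : LSmooth L h) :
    Measurable (gradient h) := hh.2.continuous.measurable

theorem measurable_clipError {m : MeasurableSpace Ω} {t : ℕ} {x c : Fin N → Ω → Vec d}
    (hf : ∀ i, LSmooth L (f i t)) (hx : ∀ i, Measurable (x i)) (hc : ∀ i, Measurable (c i)) :
    Measurable fun ω => clipError f t (fun i => x i ω) (fun i => c i ω) := by
  unfold clipError
  refine Measurable.inner ((LSmooth.globalCost hf).measurable_gradient.comp
    (measurable_average hx)) (measurable_average fun i => ?_)
  exact ((hf i).measurable_gradient.comp (hx i)).sub (hc i)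

theorem abs_clipError_le {t : ℕ} {x c : Fin N → Vec d} {Bg lam : ℝ} (hBg : 0 ≤ Bg)
    (hlam : 0 ≤ lam) (hf : ∀ i, LSmooth L (f i t))
    (hg : ∀ i, ‖gradient (f i t) (x i)‖ ≤ Bg)
    (hg' : ∀ i, ‖gradient (f i t) (average x)‖ ≤ Bg) (hc : ∀ i, ‖c i‖ ≤ lam) :
    |clipError f t x c| ≤ N * Bg * (Bg + lam) := by
  refine (abs_real_inner_le_norm _ _).trans (mul_le_mul (norm_gradient_globalCost_le hf hg') ?_
    (norm_nonneg _) (by positivity))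
  exact norm_average_le (by positivity) fun i =>
    (norm_sub_le _ _).trans (add_le_add (hg i) (hc i))

/-- The weight `Z` built from past errors and the gradient `u` at the mean state are both known
given the history, so each agent's drift bound applies; averaging over the agents keeps the bound.
-/
theorem measure_sum_clipError_ge_le [m0 : MeasurableSpace Ω] {μ : Measure Ω}
    [IsProbabilityMeasure μ] (hN : 1 ≤ N) {T : ℕ} (hT : 1 ≤ T)
    {W : ℕ → Matrix (Fin N) (Fin N) ℝ} {η lam : ℕ → ℝ} {x₁ : Fin N → Ω → Vec d}
    {g : Fin N → ℕ → Ω → Vec d → Vec d} {X : ℕ → Fin N → Ω → Vec d} {G : Fin N → ℕ → Ω → Vec d}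
    {p σ BX Bg s δ : ℝ} (hX : X = randomStates W η lam x₁ g) (hG : G = observed g X)
    (hp : 1 < p) (hBg : 0 < Bg) (hlam : ∀ t, 1 ≤ t → 2 * Bg ≤ lam t)
    (hx₁ : ∀ i, Measurable (x₁ i)) (hGm : ∀ i, ∀ t ∈ Finset.Icc 1 T, Measurable (G i t))
    (hf : ∀ i, ∀ t ∈ Finset.Icc 1 T, LSmooth L (f i t)) (hub : Unbiased μ T f x₁ X G)
    (hht : HeavyTailed μ T p σ f x₁ X G) (hbd : BoundedStates μ T BX Bg f X)
    (hs : 0 < s) (hsK : ∀ t, 1 ≤ t → t < T → s * (N * Bg * (Bg + lam t)) ≤ 1) (hδ : 0 < δ) :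
    μ.real {ω | ∑ t ∈ Finset.Ico 1 T, N * Bg * (lam t / 2) ^ (1 - p) * σ ^ p
        + s * ∑ t ∈ Finset.Ico 1 T, (N * Bg * (Bg + lam t)) ^ 2 + Real.log (1 / δ) / s
      ≤ ∑ t ∈ Finset.Ico 1 T,
        clipError f t (fun i => X t i ω) (fun i => clip (lam t) (G i t ω))} ≤ δ := by
  have hN0 : (N : ℝ) ≠ 0 := by positivity
  have hlam0 : ∀ t, 1 ≤ t → 0 < lam t := fun t ht => by linarith [hlam t ht]
  have hhist : ∀ t, t ≤ T → history x₁ G t ≤ m0 := fun t ht =>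
    history_le hx₁ fun i s h1 h2 => hGm i s (Finset.mem_Icc.2 ⟨h1, by omega⟩)
  have hXh : ∀ r t, 1 ≤ r → r ≤ t → ∀ i, Measurable[history x₁ G t] (X r i) :=
    fun r t h1 h2 i => measurable_history_states hX hG h1 h2 i
  have hyh : ∀ r t, 1 ≤ r → r < t → t ≤ T → Measurable[history x₁ G t] fun ω =>
      clipError f r (fun i => X r i ω) (fun i => clip (lam r) (G i r ω)) := fun r t h1 h2 h3 =>
    measurable_clipError (fun i => hf i r (Finset.mem_Icc.2 ⟨h1, by omega⟩))
      (hXh r t h1 h2.le) fun i => measurable_clip.comp (measurable_history_gradient h1 h2 i)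
  have hyK : ∀ t, 1 ≤ t → t < T → ∀ᵐ ω ∂μ,
      |clipError f t (fun i => X t i ω) (fun i => clip (lam t) (G i t ω))|
        ≤ N * Bg * (Bg + lam t) := by
    intro t h1 h2
    have ht : t ∈ Finset.Icc 1 T := Finset.mem_Icc.2 ⟨h1, h2.le⟩
    filter_upwards [hbd] with ω hω
    exact abs_clipError_le hBg.le (hlam0 t h1).le (fun i => hf i t ht) (fun i => (hω t ht i).2.1)
      (fun i => (hω t ht i).2.2) fun i => norm_clip_le (hlam0 t h1).le _
  refine measure_sum_ge_le hs hT
    (fun t h1 h2 => (hyh t (t + 1) h1 (by omega) h2).mono (hhist _ h2) le_rfl) hyK hsK ?_ hδ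
  intro t h1 h2
  have ht : t ∈ Finset.Icc 1 T := Finset.mem_Icc.2 ⟨h1, h2.le⟩
  set y : ℕ → Ω → ℝ := fun t ω =>
    clipError f t (fun i => X t i ω) (fun i => clip (lam t) (G i t ω))
  set Z : Ω → ℝ := fun ω => Real.exp (s * ∑ r ∈ Finset.Ico 1 t, y r ω)
  set u : Ω → Vec d := fun ω => gradient (globalCost f t) (average fun i => X t i ω)
  have hZ : Measurable[history x₁ G t] Z :=
    measurable_exp_sum fun r hr1 hr2 => hyh r t hr1 hr2 h2.le
  have hZC : ∀ᵐ ω ∂μ, |Z ω| ≤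
      Real.exp (s * ∑ r ∈ Finset.Ico 1 t, N * Bg * (Bg + lam r)) := by
    filter_upwards [ae_exp_sum_le hs.le hyK h2.le] with ω hω
    rwa [abs_of_nonneg (Real.exp_nonneg _)]
  have hu : Measurable[history x₁ G t] u :=
    (LSmooth.globalCost fun i => hf i t ht).measurable_gradient.comp
      (measurable_average (hXh t t h1 le_rfl))
  have huU : ∀ᵐ ω ∂μ, ‖u ω‖ ≤ N * Bg := by
    filter_upwards [hbd] with ω hω
    exact norm_gradient_globalCost_le (fun i => hf i t ht) fun i => (hω t ht i).2.2
  have hi : ∀ i, _ := fun i => integral_mul_inner_sub_clip_le (hhist t h2.le) (hlam0 t h1) hp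
    (by positivity) hZ (fun ω => Real.exp_nonneg _) hZC hu huU (hub t ht i).1 (hub t ht i).2
    (by
      filter_upwards [hbd] with ω hω
      linarith [(hω t ht i).2.1, hlam t h1]) (hht t ht i).1 (hht t ht i).2
  have heq : ∀ ω, Z ω * y t ω = (N : ℝ)⁻¹ *
      ∑ i, Z ω * inner ℝ (u ω) (gradient (f i t) (X t i ω) - clip (lam t) (G i t ω)) := by
    intro ω
    rw [← Finset.mul_sum]
    change Z ω * inner ℝ (u ω) (average _) = _
    rw [inner_average]
    ring
  change ∫ ω, Z ω * y t ω ∂μ ≤ _ * ∫ ω, Z ω ∂μ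
  rw [integral_congr_ae (Filter.Eventually.of_forall heq), integral_const_mul,
    integral_finsetSum _ fun i _ => (hi i).1, inv_mul_le_iff₀ (by positivity)]
  refine (Finset.sum_le_sum fun i _ => (hi i).2).trans_eq ?_
  rw [Finset.sum_const, Finset.card_univ, Fintype.card_fin, nsmul_eq_mul]

end Tail

/-! ### Polynomial step sizes and clipping levels -/

section Rates

variable {a b κ α Bg : ℝ}

theorem clipLevel_nonneg (hBg : 0 < Bg) (t : ℕ) : 0 ≤ clipLevel Bg α t := by
  unfold clipLevel
  positivity

theorem two_mul_le_clipLevel (hBg : 0 < Bg) (hα : 0 ≤ α) {t : ℕ} (ht : 1 ≤ t) :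
    2 * Bg ≤ clipLevel Bg α t :=
  le_mul_of_one_le_right (by positivity) (Real.one_le_rpow (by exact_mod_cast ht) hα)

theorem add_clipLevel_le (hBg : 0 < Bg) (hα : 0 ≤ α) {t : ℕ} (ht : 1 ≤ t) :
    Bg + clipLevel Bg α t ≤ 3 * Bg * (t : ℝ) ^ α := by
  have := two_mul_le_clipLevel hBg hα ht
  unfold clipLevel at this ⊢
  linarith

/-- The relation between `α`, `p` and `κ` puts the clipping bias at order `t ^ (κ - 1)`. -/
theorem half_clipLevel_rpow (hBg : 0 < Bg) {p : ℝ} (h : α * (1 - p) = κ - 1) (t : ℕ) :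
    (clipLevel Bg α t / 2) ^ (1 - p) = Bg ^ (1 - p) * (t : ℝ) ^ (κ - 1) := by
  have h1 : clipLevel Bg α t / 2 = Bg * (t : ℝ) ^ α := by
    unfold clipLevel
    ring
  rw [h1, Real.mul_rpow hBg.le (by positivity), ← Real.rpow_mul (Nat.cast_nonneg t), h]

theorem stepSize_mul_clipLevel_sq_le (ha : 0 < a) (hab : 0 < a + b) (hκ : 0 ≤ κ)
    (h : 2 * α = 2 * κ - 1) {t : ℕ} (ht : 1 ≤ t) :
    stepSize a b κ t * clipLevel Bg α t ^ 2
      ≤ 4 * Bg ^ 2 * (min a (a + b)) ^ (-κ) * (t : ℝ) ^ (κ - 1) := by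
  have ht0 : (0 : ℝ) < t := by exact_mod_cast ht
  have h1 : clipLevel Bg α t ^ 2 = 4 * Bg ^ 2 * (t : ℝ) ^ (2 * κ - 1) := by
    rw [clipLevel, ← h, mul_pow, two_mul α, Real.rpow_add ht0]
    ring
  have h2 : (t : ℝ) ^ (κ - 1) = (t : ℝ) ^ (-κ) * (t : ℝ) ^ (2 * κ - 1) := by
    rw [← Real.rpow_add ht0]
    congr 1
    ring
  calc stepSize a b κ t * clipLevel Bg α t ^ 2
      ≤ ((min a (a + b)) ^ (-κ) * (t : ℝ) ^ (-κ)) * clipLevel Bg α t ^ 2 :=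
        mul_le_mul_of_nonneg_right (stepSize_le ha hab hκ ht) (sq_nonneg _)
    _ = _ := by rw [h1, h2]; ring

theorem stepSize_mul_clipLevel_le (ha : 0 < a) (hab : 0 < a + b) (hBg : 0 < Bg)
    (hκ : 1 / 2 ≤ κ) (h : 2 * α = 2 * κ - 1) {t : ℕ} (ht : 1 ≤ t) :
    stepSize a b κ t * clipLevel Bg α t
      ≤ 2 * Bg * (min a (a + b)) ^ (-κ) * (t : ℝ) ^ (κ - 1) := by
  have ht1 : (1 : ℝ) ≤ t := by exact_mod_cast ht
  have hc : 0 < min a (a + b) := lt_min ha hab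
  calc stepSize a b κ t * clipLevel Bg α t
      ≤ ((min a (a + b)) ^ (-κ) * (t : ℝ) ^ (-κ)) * clipLevel Bg α t :=
        mul_le_mul_of_nonneg_right (stepSize_le ha hab (by linarith) ht) (clipLevel_nonneg hBg t)
    _ = 2 * Bg * (min a (a + b)) ^ (-κ) * (t : ℝ) ^ (-κ + α) := by
        rw [clipLevel, Real.rpow_add (by linarith)]
        ring
    _ ≤ _ := by
        gcongr
        -- Since `α = κ - 1 / 2`, the exponent `-κ + α` is `-1 / 2`, which is at most `κ - 1`
        -- because `κ ≥ 1 / 2`.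
        linarith

theorem sum_Ico_rpow_le (h0 : 0 < κ) (h1 : κ ≤ 1) {u : ℕ → ℝ} {c : ℝ} (hc : 0 ≤ c) (T : ℕ)
    (hu : ∀ t, 1 ≤ t → u t ≤ c * (t : ℝ) ^ (κ - 1)) :
    ∑ t ∈ Finset.Ico 1 T, u t ≤ c / κ * (T : ℝ) ^ κ := by
  calc ∑ t ∈ Finset.Ico 1 T, u t ≤ ∑ t ∈ Finset.Ico 1 T, c * (t : ℝ) ^ (κ - 1) :=
        Finset.sum_le_sum fun t ht => hu t (Finset.mem_Ico.1 ht).1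
    _ ≤ ∑ t ∈ Finset.Icc 1 T, c * (t : ℝ) ^ (κ - 1) :=
        Finset.sum_le_sum_of_subset_of_nonneg Finset.Ico_subset_Icc_self
          fun t _ _ => by positivity
    _ ≤ c * ((T : ℝ) ^ κ / κ) := by
        rw [← Finset.mul_sum]
        exact mul_le_mul_of_nonneg_left (sum_rpow_sub_one_le h0 h1 T) hc
    _ = _ := by ring

/-- With clipping levels of order `t ^ (κ - 1 / 2)`, the squared ranges of the clipped gradients
sum up to the order `T ^ (2 κ)`. -/
theorem sum_sq_add_clipLevel_le (hBg : 0 < Bg) (hα : 0 ≤ α) (h : 2 * α = 2 * κ - 1) {c : ℝ}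
    (hc : 0 ≤ c) {T : ℕ} (hT : 1 ≤ T) :
    ∑ t ∈ Finset.Ico 1 T, (c * (Bg + clipLevel Bg α t)) ^ 2
      ≤ (3 * c * Bg * (T : ℝ) ^ κ) ^ 2 := by
  have hT0 : (0 : ℝ) < T := by exact_mod_cast hT
  have h1 : ∀ t ∈ Finset.Ico 1 T, (c * (Bg + clipLevel Bg α t)) ^ 2
      ≤ (3 * c * Bg * (T : ℝ) ^ α) ^ 2 := by
    intro t ht
    rw [Finset.mem_Ico] at ht
    have h2 : c * (Bg + clipLevel Bg α t) ≤ 3 * c * Bg * (T : ℝ) ^ α := by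
      calc c * (Bg + clipLevel Bg α t) ≤ c * (3 * Bg * (t : ℝ) ^ α) :=
            mul_le_mul_of_nonneg_left (add_clipLevel_le hBg hα ht.1) hc
        _ ≤ c * (3 * Bg * (T : ℝ) ^ α) := by
            have : (t : ℝ) ≤ T := by exact_mod_cast ht.2.le
            gcongr
        _ = _ := by ring
    have h3 := clipLevel_nonneg (α := α) hBg t
    gcongr
  have h4 : (T : ℝ) * ((T : ℝ) ^ α) ^ 2 = ((T : ℝ) ^ κ) ^ 2 := by
    rw [← Real.rpow_mul_natCast hT0.le, ← Real.rpow_mul_natCast hT0.le]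
    nth_rw 1 [← Real.rpow_one (T : ℝ)]
    rw [← Real.rpow_add hT0]
    congr 1
    push_cast
    linarith
  calc _ ≤ ∑ t ∈ Finset.Ico 1 T, (3 * c * Bg * (T : ℝ) ^ α) ^ 2 := Finset.sum_le_sum h1
    _ = ((T - 1 : ℕ) : ℝ) * (3 * c * Bg * (T : ℝ) ^ α) ^ 2 := by simp
    _ ≤ T * (3 * c * Bg * (T : ℝ) ^ α) ^ 2 := by
        gcongr
        exact Nat.sub_le _ _
    _ = (3 * c * Bg) ^ 2 * (T * ((T : ℝ) ^ α) ^ 2) := by ring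
    _ = _ := by rw [h4]; ring

end Rates

/-- The accumulated spread of the states of the clipped algorithm is of order `T ^ κ`. -/
theorem NetworkAssumption.sum_spread_clip_le {N d : ℕ} {w : ℝ} {B : ℕ}
    {edge : ℕ → Fin N → Fin N → Prop} {W : ℕ → Matrix (Fin N) (Fin N) ℝ}
    (hnet : NetworkAssumption w B edge W) (hw0 : 0 < w) (hw1 : w < 1) {a b κ α BX Bg : ℝ}
    (ha : 0 < a) (hab : 0 < a + b) (hBX : 0 ≤ BX) (hBg : 0 < Bg) (hκ2 : 1 / 2 ≤ κ) (hκ1 : κ ≤ 1)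
    (hακ : 2 * α = 2 * κ - 1) {T : ℕ} (hT : 1 ≤ T) {x G : ℕ → Fin N → Vec d}
    (hx : ∀ t ∈ Finset.Icc 1 T, ∀ i, ‖x t i‖ ≤ BX)
    (hstep : ∀ t, 1 ≤ t → t < T → ∀ i, x (t + 1) i
      = ∑ j, W t i j • x t j - stepSize a b κ t • clip (clipLevel Bg α t) (G t i)) :
    ∑ t ∈ Finset.Icc 1 T, spread (x t)
      ≤ (N * B : ℕ) * (2 * BX + 2 * (2 * Bg * (min a (a + b)) ^ (-κ) / κ))
        / (w ^ (N * B)) ^ 2 * (T : ℝ) ^ κ := by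
  have hmin : 0 < min a (a + b) := lt_min ha hab
  have hκ0 : 0 < κ := by linarith
  have hT1 : (1 : ℝ) ≤ T := by exact_mod_cast hT
  have hP1 : 1 ≤ (T : ℝ) ^ κ := Real.one_le_rpow hT1 hκ0.le
  set E₁ : ℝ := 2 * Bg * (min a (a + b)) ^ (-κ)
  have hE₁0 : 0 ≤ E₁ := by positivity
  have h1 := hnet.sum_spread_le hw0 hw1 (x := x)
    (e := fun t => E₁ * (t : ℝ) ^ (κ - 1)) (fun t => by positivity) (T := T) (D := 2 * BX) ?_
    (by positivity) ?_
  · have h2 : ∑ t ∈ Finset.Ico 1 T, E₁ * (t : ℝ) ^ (κ - 1) ≤ E₁ / κ * (T : ℝ) ^ κ :=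
      sum_Ico_rpow_le hκ0 hκ1 hE₁0 T fun t _ => le_rfl
    have h3 : 2 * BX ≤ 2 * BX * (T : ℝ) ^ κ := le_mul_of_one_le_right (by positivity) hP1
    rw [div_mul_eq_mul_div, le_div_iff₀' (by positivity)]
    refine h1.trans ?_
    rw [mul_assoc, add_mul, mul_assoc 2 (E₁ / κ)]
    exact mul_le_mul_of_nonneg_left (add_le_add h3 (by linarith)) (Nat.cast_nonneg _)
  · intro t h1 h2 i
    rw [hstep t h1 h2 i, sub_sub_cancel_left, norm_neg, norm_smul,
      Real.norm_of_nonneg (stepSize_pos ha hab h1).le]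
    exact (mul_le_mul_of_nonneg_left (norm_clip_le (clipLevel_nonneg hBg t) _)
      (stepSize_pos ha hab h1).le).trans (stepSize_mul_clipLevel_le ha hab hBg hκ2 hακ h1)
  · intro t ht
    exact spread_le (by positivity) fun i j =>
      (norm_sub_le _ _).trans (by linarith [hx t ht i, hx t ht j])

/-- Absorbing the terms of the regret bound into a multiple of `P * (1 + D + ℓ)`. -/
theorem regret_bound_le {P D ℓ n A β M Θ K H S C R₁ R₂ : ℝ} (hP : 1 ≤ P) (hD : 0 ≤ D)
    (hℓ : 0 ≤ ℓ) (hn : 0 ≤ n) (hA : 0 ≤ A) (hβ : 0 ≤ β) (hM : 0 ≤ M) (hΘ : 0 ≤ Θ) (hK : 0 ≤ K)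
    (hH : 0 ≤ H) (hS : 0 ≤ S) (hC : 0 ≤ C) (hR₁ : 0 ≤ R₁) (hR₂ : 0 ≤ R₂) :
    2 * n * (A * (S * P) + (β + M * (1 + ℓ)) * P + Θ * P * (2 * K + 3 * D) + H * (C * P))
        + R₁ + R₂ * (S * P)
      ≤ (2 * n * (A * S + (β + M) + Θ * (2 * K + 3) + H * C) + R₁ + R₂ * S) * P
        * (1 + D + ℓ) := by
  have hP0 : 0 ≤ P := zero_le_one.trans hP
  set Q := 1 + D + ℓ with hQ
  have hQ1 : 1 ≤ Q := by linarith
  have h1 : β + M * (1 + ℓ) ≤ (β + M) * Q := by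
    rw [add_mul]
    exact add_le_add (le_mul_of_one_le_right hβ hQ1)
      (mul_le_mul_of_nonneg_left (by linarith) hM)
  have h2 : 2 * K + 3 * D ≤ (2 * K + 3) * Q := by
    rw [add_mul]
    exact add_le_add (le_mul_of_one_le_right (by positivity) hQ1) (by linarith)
  have h3 : P ≤ P * Q := le_mul_of_one_le_right hP0 hQ1
  have h4 : R₁ ≤ R₁ * (P * Q) :=
    le_mul_of_one_le_right hR₁ (hP.trans h3)
  calc _ ≤ 2 * n * (A * (S * (P * Q)) + (β + M) * Q * P + Θ * P * ((2 * K + 3) * Q)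
          + H * (C * (P * Q))) + R₁ * (P * Q) + R₂ * (S * (P * Q)) := by gcongr
    _ = _ := by ring

/-- Subadditivity alone is used, so neither event has to be measurable. -/
theorem ofReal_one_sub_le_measure {Ω : Type*} [MeasurableSpace Ω] {μ : Measure Ω}
    [IsProbabilityMeasure μ] {s t : Set Ω} {δ : ℝ} (hs : μ.real s ≤ δ)
    (ht : ∀ᵐ ω ∂μ, ω ∉ s → ω ∈ t) : ENNReal.ofReal (1 - δ) ≤ μ t := by
  have h1 : μ sᶜ ≤ μ t := measure_mono_ae ht
  have h2 : (1 : ENNReal) ≤ μ s + μ sᶜ := by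
    rw [← measure_univ (μ := μ), ← Set.union_compl_self s]
    exact measure_union_le _ _
  have h3 : μ s ≤ ENNReal.ofReal δ :=
    (ofReal_measureReal (μ := μ) (s := s)) ▸ ENNReal.ofReal_le_ofReal hs
  rw [ENNReal.ofReal_sub _ (measureReal_nonneg.trans hs), ENNReal.ofReal_one]
  exact tsub_le_iff_left.2 (h2.trans (add_le_add h3 h1))

end ODCSGD

end

/-! ### Choice of constants and assembly -/

theorem corollary2 (N : ℕ) (hN : 1 ≤ N)
    (p : ℝ) (hp : 1 < p ∧ p ≤ 2) (σ : ℝ) (hσ : 0 < σ) (L : ℝ≥0)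
    (BX Bg : ℝ) (hBX : 0 < BX) (hBg : 0 < Bg)
    (w : ℝ) (hw : 0 < w ∧ w < 1) (B : ℕ) (hB : 1 ≤ B)
    (a b : ℝ) (ha : 0 < a) (hab : 0 < a + b) :
    ∃ C : ℝ, 0 < C ∧
      ∀ (d : ℕ) (Ω : Type*) [MeasurableSpace Ω] (μ : Measure Ω) [IsProbabilityMeasure μ]
        (edge : ℕ → Fin N → Fin N → Prop) (W : ℕ → Matrix (Fin N) (Fin N) ℝ)
        (f : Fin N → ℕ → ODCSGD.Vec d → ℝ)
        (x₁ : Fin N → Ω → ODCSGD.Vec d)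
        (g : Fin N → ℕ → Ω → ODCSGD.Vec d → ODCSGD.Vec d)
        (X : ℕ → Fin N → Ω → ODCSGD.Vec d) (G : Fin N → ℕ → Ω → ODCSGD.Vec d)
        (T : ℕ) (δ : ℝ),
        X = ODCSGD.randomStates W (ODCSGD.stepSize a b ((p + 1) / (2 * p)))
              (ODCSGD.clipLevel Bg (1 / (2 * p))) x₁ g →
        G = ODCSGD.observed g X →
        1 ≤ T → 0 < δ → δ < 1 →
        ODCSGD.NetworkAssumption w B edge W →
        (∀ i, Measurable (x₁ i)) →
        (∀ i, ∀ t ∈ Finset.Icc 1 T, Measurable (G i t)) →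
        (∀ i, ∀ t ∈ Finset.Icc 1 T, ODCSGD.LSmooth L (f i t)) →
        ODCSGD.Unbiased μ T f x₁ X G →
        ODCSGD.HeavyTailed μ T p σ f x₁ X G →
        ODCSGD.BoundedStates μ T BX Bg f X →
        ODCSGD.FiniteVariation f T →
        ENNReal.ofReal (1 - δ) ≤
          μ {ω | ODCSGD.nreg f (fun t i => X t i ω) T ≤
            C * (T : ℝ) ^ ((1 + p) / (2 * p)) *
              (1 + ODCSGD.variation f T + Real.log (1 / δ))} := by
  obtain ⟨hp1, hp2⟩ := hp
  obtain ⟨hw0, hw1⟩ := hw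
  have hp0 : 0 < p := by linarith
  rw [add_comm 1 p]
  set κ : ℝ := (p + 1) / (2 * p) with hκ
  set α : ℝ := 1 / (2 * p) with hα
  have hκ2 : 1 / 2 ≤ κ := by rw [hκ, div_le_div_iff₀ (by norm_num) (by positivity)]; linarith
  have hκ1 : κ ≤ 1 := by rw [hκ, div_le_one (by positivity)]; linarith
  have hκ0 : 0 < κ := by linarith
  have hα0 : 0 ≤ α := by positivity
  have hακ : 2 * α = 2 * κ - 1 := by rw [hκ, hα]; field_simp; ring
  have hαp : α * (1 - p) = κ - 1 := by rw [hκ, hα]; field_simp; ring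
  have hακ' : α ≤ κ := by linarith
  have hNpos : (0 : ℝ) < N := by exact_mod_cast hN
  have hmin : 0 < min a (a + b) := lt_min ha hab
  -- the coefficients of `T ^ κ` in the bounds for the accumulated spread, the second-order terms,
  -- the clipping bias and the inverse of the last step size
  set CS : ℝ := (N * B : ℕ) * (2 * BX + 2 * (2 * Bg * (min a (a + b)) ^ (-κ) / κ))
    / (w ^ (N * B)) ^ 2
  set CH : ℝ := 4 * Bg ^ 2 * (min a (a + b)) ^ (-κ) / κ with hCH
  set Cβ : ℝ := N * Bg * Bg ^ (1 - p) * σ ^ p / κ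
  set CΘ : ℝ := (a + |b|) ^ κ with hCΘ
  set K₀ : ℝ := N * Bg * (2 * BX) + N * L * (2 * BX) ^ 2 with hK₀
  -- The clipping error at time `t` is bounded by `N * Bg * (Bg + lam t)`, which is at most `M * t ^
  -- α`.
  set M : ℝ := 3 * N * Bg * Bg with hM
  have hCS0 : 0 ≤ CS := by positivity
  have hCH0 : 0 ≤ CH := by positivity
  have hCβ0 : 0 ≤ Cβ := by positivity
  have hCΘ0 : 0 ≤ CΘ := by positivity
  have hK₀0 : 0 ≤ K₀ := by positivity
  have hM0 : 0 < M := by positivity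
  refine ⟨2 * N ^ 2 * (N * Bg * L * CS + (Cβ + M) + CΘ * (2 * K₀ + 3) + N * L * CH)
    + 2 * N * (N * Bg) ^ 2 + 4 * N * (N * L) ^ 2 * BX * CS, by positivity, ?_⟩
  intro d Ω _ μ _ edge W f x₁ g X G T δ hX hG hT hδ0 hδ1 hnet hx₁ hGm hf hub hht hbd hfin
  set η := ODCSGD.stepSize a b κ
  set lam := ODCSGD.clipLevel Bg α with hlam
  have hT1 : (1 : ℝ) ≤ T := by exact_mod_cast hT
  set P : ℝ := (T : ℝ) ^ κ with hP
  have hP1 : 1 ≤ P := Real.one_le_rpow hT1 hκ0.le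
  have hP0 : 0 < P := by linarith
  set ℓ := Real.log (1 / δ)
  have hℓ0 : 0 ≤ ℓ := Real.log_nonneg (by rw [le_div_iff₀ hδ0]; linarith)
  set D := ODCSGD.variation f T with hD
  have hD0 : 0 ≤ D := ODCSGD.variation_nonneg
  -- This scale balances the variance term, at most `M * P`, with the confidence term `M * P * ℓ`,
  -- and it is small enough for the exponential-moment bound because `α ≤ κ`.
  set s : ℝ := 1 / (M * P) with hs
  have hs0 : 0 < s := by positivity
  have hlam0 : ∀ t, 0 ≤ lam t := fun t => ODCSGD.clipLevel_nonneg hBg t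
  have htail := ODCSGD.measure_sum_clipError_ge_le hN hT hX hG hp1 hBg
    (fun t ht => ODCSGD.two_mul_le_clipLevel hBg hα0 ht) hx₁ hGm hf hub hht hbd hs0 ?_ hδ0
  swap
  · intro t h1 h2
    have h3 : (t : ℝ) ^ α ≤ P :=
      calc (t : ℝ) ^ α ≤ (T : ℝ) ^ α := by
            have : (t : ℝ) ≤ T := by exact_mod_cast h2.le
            gcongr
        _ ≤ P := Real.rpow_le_rpow_of_exponent_le hT1 hακ'
    rw [hs, one_div, inv_mul_le_iff₀ (by positivity), mul_one]
    calc N * Bg * (Bg + lam t) ≤ N * Bg * (3 * Bg * (t : ℝ) ^ α) := by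
          have := ODCSGD.add_clipLevel_le hBg hα0 h1
          gcongr
      _ ≤ N * Bg * (3 * Bg * P) := by gcongr
      _ = M * P := by rw [hM]; ring
  refine ODCSGD.ofReal_one_sub_le_measure htail ?_
  have hthr : ∑ t ∈ Finset.Ico 1 T, N * Bg * (lam t / 2) ^ (1 - p) * σ ^ p
      + s * ∑ t ∈ Finset.Ico 1 T, (N * Bg * (Bg + lam t)) ^ 2 + ℓ / s
      ≤ (Cβ + M * (1 + ℓ)) * P := by
    have h1 : ∑ t ∈ Finset.Ico 1 T, N * Bg * (lam t / 2) ^ (1 - p) * σ ^ p ≤ Cβ * P := by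
      refine ODCSGD.sum_Ico_rpow_le hκ0 hκ1 (by positivity) T fun t _ => ?_
      rw [hlam, ODCSGD.half_clipLevel_rpow hBg hαp]
      exact le_of_eq (by ring)
    have h2 : s * ∑ t ∈ Finset.Ico 1 T, (N * Bg * (Bg + lam t)) ^ 2 ≤ M * P := by
      have h3 := ODCSGD.sum_sq_add_clipLevel_le hBg hα0 hακ (c := N * Bg) (by positivity) hT
      rw [hs, one_div, inv_mul_le_iff₀ (by positivity)]
      refine h3.trans_eq ?_
      rw [hM, hP]
      ring
    have h3 : ℓ / s = M * P * ℓ := by rw [hs]; field_simp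
    rw [h3]
    linarith
  -- Off the bad event the rest of the argument is deterministic.
  filter_upwards [hbd] with ω hω hgood
  have hY := ((not_le.1 hgood).trans_le hthr).le
  have hx : ∀ t ∈ Finset.Icc 1 T, ∀ i, ‖X t i ω‖ ≤ BX := fun t ht i => (hω t ht i).1
  have hstep : ∀ t, 1 ≤ t → t < T → ∀ i,
      X (t + 1) i ω = ∑ j, W t i j • X t j ω - η t • ODCSGD.clip (lam t) (G i t ω) :=
    fun t h1 _ i => ODCSGD.randomStates_succ hX hG h1 i ω
  have hS : ∑ t ∈ Finset.Icc 1 T, ODCSGD.spread (fun i => X t i ω) ≤ CS * P :=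
    hnet.sum_spread_clip_le hw0 hw1 ha hab hBX.le hBg hκ2 hκ1 hακ hT hx hstep
  have hnreg := ODCSGD.nreg_le hN hT (x := fun t i => X t i ω)
    (c := fun t i => ODCSGD.clip (lam t) (G i t ω))
    (fun t h1 h2 => ODCSGD.average_step (hnet.col_sum t h1) (hstep t h1 h2))
    (fun t h1 => ODCSGD.stepSize_pos ha hab h1)
    (fun t h1 => ODCSGD.inv_stepSize_mono ha hab hκ0.le h1) hlam0
    (fun t i => ODCSGD.norm_clip_le (hlam0 t) _) hf hx (fun t ht i => (hω t ht i).2.2) hfin hS hY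
    (ODCSGD.sum_Ico_rpow_le hκ0 hκ1 (by positivity) T fun t h1 =>
      ODCSGD.stepSize_mul_clipLevel_sq_le ha hab hκ0.le hακ h1)
    (ODCSGD.inv_stepSize_le ha hab hκ0.le hT)
  refine hnreg.trans ?_
  rw [← hCH, ← hCΘ, ← hP, ← hK₀, ← hD]
  exact ODCSGD.regret_bound_le hP1 hD0 hℓ0 (by positivity) (by positivity) hCβ0 hM0.le hCΘ0 hK₀0
    (by positivity) hCS0 hCH0 (by positivity) (by positivity)
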